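/- Let $\gamma=\lim_{n\to\infty}\big(\sum_{k=1}^n \tfrac1k-\log n\big)$ be the Euler--Mascheroni constant, and set $$c_0:=-\frac{\gamma}{2}-\frac12\int_0^\infty\Big(\frac12-\frac1\zeta+\frac1{e^\zeta-1}\Big)\frac{1}{e^{\zeta/2}-1}\,d\zeta,\qquad c_1:=\frac{\gamma}{2}+\frac14\int_0^\infty\Big(1-\frac1\zeta+\frac1{e^\zeta-1}\Big)\frac{\zeta}{e^{\zeta/2}-1}\,d\zeta .$$ Both integrals converge absolutely and $c_1>0$. For a real random variable $X$ let $$d_{KS}(X,N):=\sup_{r\in\mathbb R}\left|\mathbb P[X<r]-\int_{-\infty}^r\frac{e^{-u^2/2}}{\sqrt{2\pi}}\,du\right|$$ denote its Kolmogorov--Smirnov distance to a standard Gaussian random variable $N$. Then there is an absolute constant $C\in(0,\infty)$ such that for every integer $n\ge 2$ and every $n\times n$ random matrix $A^n$ whose entries are independent standard Gaussian random variables, $$d_{KS}\left(\frac{\log|\det(A^n)|-\big(\tfrac12\log (n-1)!+c_0\big)}{\sqrt{\tfrac12\log n+c_1}},\,N\right)\le\frac{C}{(\log n)^{3/2}}.$$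 -/

import Mathlib

open MeasureTheory ProbabilityTheory

/-- The integrand `(1/2 - 1/ζ + 1/(e^ζ - 1)) * 1/(e^{ζ/2} - 1)` in the constant `c₀`. -/
noncomputable def meanIntegrand (ζ : ℝ) : ℝ :=
  (1 / 2 - 1 / ζ + 1 / (Real.exp ζ - 1)) * (1 / (Real.exp (ζ / 2) - 1))

/-- The integrand `(1 - 1/ζ + 1/(e^ζ - 1)) * ζ/(e^{ζ/2} - 1)` in the constant `c₁`. -/
noncomputable def varIntegrand (ζ : ℝ) : ℝ :=
  (1 - 1 / ζ + 1 / (Real.exp ζ - 1)) * (ζ / (Real.exp (ζ / 2) - 1))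

/-- The centering constant `c₀`. -/
noncomputable def gaussC0 : ℝ :=
  -(Real.eulerMascheroniConstant / 2) - 1 / 2 * ∫ ζ in Set.Ioi (0 : ℝ), meanIntegrand ζ

/-- The variance constant `c₁`. -/
noncomputable def gaussC1 : ℝ :=
  Real.eulerMascheroniConstant / 2 + 1 / 4 * ∫ ζ in Set.Ioi (0 : ℝ), varIntegrand ζ

/-- The Kolmogorov(-Smirnov) distance between (the law under `P` of) a real random variable `X`
and a standard Gaussian random variable. The supremum is over quantities in `[0, 1]`. -/
noncomputable def ksDistGaussian {Ω : Type*} [MeasurableSpace Ω] (P : Measure Ω) (X : Ω → ℝ) : ℝ :=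
  ⨆ r : ℝ, |P.real {ω | X ω < r} -
    ∫ u in Set.Iic r, Real.exp (-u ^ 2 / 2) / Real.sqrt (2 * Real.pi)|

/-- The standard Gaussian measure on `Fin n → ℝ`. -/
noncomputable def gaussVec (n : ℕ) : Measure (Fin n → ℝ) :=
  Measure.pi fun _ => gaussianReal 0 1

/-- The law of a square matrix with independent standard Gaussian entries. -/
noncomputable def gaussMat (n : ℕ) : Measure (Fin n → Fin n → ℝ) :=
  Measure.pi fun _ => gaussVec n

instance (n : ℕ) : IsProbabilityMeasure (gaussVec n) := by
  unfold gaussVec; infer_instance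

instance (n : ℕ) : IsProbabilityMeasure (gaussMat n) := by
  unfold gaussMat; infer_instance

lemma measurePreserving_toLp_gaussVec (n : ℕ) :
    MeasurePreserving (WithLp.toLp 2) (gaussVec n) (stdGaussian (EuclideanSpace ℝ (Fin n))) :=
  ⟨by fun_prop, map_pi_eq_stdGaussian⟩

lemma measurePreserving_ofLp_stdGaussian (n : ℕ) :
    MeasurePreserving (WithLp.ofLp) (stdGaussian (EuclideanSpace ℝ (Fin n))) (gaussVec n) := by
  refine ⟨by fun_prop, ?_⟩
  rw [← (measurePreserving_toLp_gaussVec n).map_eq, Measure.map_map (by fun_prop) (by fun_prop)]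
  exact Measure.map_id

/-- Every vector is moved to the first coordinate axis by a linear map of determinant `±1`
which preserves the standard Gaussian measure. -/
lemma exists_gaussVec_rotation {n : ℕ} (v : Fin (n + 1) → ℝ) :
    ∃ f : (Fin (n + 1) → ℝ) →ₗ[ℝ] (Fin (n + 1) → ℝ), |LinearMap.det f| = 1 ∧
      f v = Pi.single 0 ‖WithLp.toLp 2 v‖ ∧
      MeasurePreserving f (gaussVec (n + 1)) (gaussVec (n + 1)) := by
  set w : EuclideanSpace ℝ (Fin (n + 1)) := EuclideanSpace.single 0 ‖WithLp.toLp 2 v‖ with hw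
  set u : EuclideanSpace ℝ (Fin (n + 1)) := WithLp.toLp 2 v with hu
  have hnorm : ‖u‖ = ‖w‖ := by simp [hw]
  set T := (ℝ ∙ (u - w))ᗮ.reflection with hT
  have hTu : T u = w := Submodule.reflection_sub hnorm
  refine ⟨(WithLp.linearEquiv 2 ℝ (Fin (n + 1) → ℝ)).toLinearMap ∘ₗ T.toLinearMap ∘ₗ
    (WithLp.linearEquiv 2 ℝ (Fin (n + 1) → ℝ)).symm.toLinearMap, ?_, ?_, ?_⟩
  · rw [LinearMap.det_conj]
    have := (ℝ ∙ (u - w))ᗮ.det_reflection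
    rw [hT, this]
    simp
  · change WithLp.ofLp (T u) = _
    rw [hTu, hw]
    rfl
  · have hTm : MeasurePreserving T (stdGaussian (EuclideanSpace ℝ (Fin (n + 1))))
      (stdGaussian (EuclideanSpace ℝ (Fin (n + 1)))) := ⟨by fun_prop, stdGaussian_map T⟩
    exact (measurePreserving_ofLp_stdGaussian _).comp
      (hTm.comp (measurePreserving_toLp_gaussVec _))

lemma measurePreserving_tail_gaussVec (n : ℕ) :
    MeasurePreserving (fun x : Fin (n + 1) → ℝ => fun j : Fin n => x j.succ)
      (gaussVec (n + 1)) (gaussVec n) := by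
  have h := measurePreserving_piFinSuccAbove (α := fun _ : Fin (n + 1) => ℝ)
    (fun _ => gaussianReal 0 1) 0
  exact measurePreserving_snd.comp h

lemma det_cons_single {n : ℕ} (c : ℝ) (R : Fin n → Fin (n + 1) → ℝ) :
    (Matrix.of (Fin.cons (Pi.single 0 c) R : Fin (n + 1) → Fin (n + 1) → ℝ)).det =
      c * (Matrix.of fun i j : Fin n => R i j.succ).det := by
  rw [Matrix.det_succ_row_zero, Finset.sum_eq_single 0]
  · simp
    left
    rfl
  · intro b _ hb
    simp [hb]
  · simp

lemma abs_det_map {n : ℕ} (f : (Fin n → ℝ) →ₗ[ℝ] (Fin n → ℝ)) (hf : |LinearMap.det f| = 1)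
    (M : Fin n → Fin n → ℝ) : |(Matrix.of fun i => f (M i)).det| = |(Matrix.of M).det| := by
  rw [← Pi.basisFun_det_apply, ← Pi.basisFun_det_apply]
  have := (Pi.basisFun ℝ (Fin n)).det_comp f M
  rw [show (fun i => f (M i)) = f ∘ M from rfl, this, abs_mul, hf, one_mul]

lemma measurable_abs_det (n : ℕ) :
    Measurable fun M : Fin n → Fin n → ℝ => |(Matrix.of M).det| := by
  have : Continuous fun M : Fin n → Fin n → ℝ => |(Matrix.of M).det| := by
    refine continuous_abs.comp (Continuous.matrix_det ?_)
    fun_prop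
  exact this.measurable

/-- Given the first row, the absolute determinant of a Gaussian matrix is distributed as the length
of that row times the absolute determinant of a smaller Gaussian matrix. -/
lemma map_abs_det_cons {n : ℕ} (v : Fin (n + 1) → ℝ) :
    (Measure.pi fun _ : Fin n => gaussVec (n + 1)).map
        (fun R => |(Matrix.of (Fin.cons v R : Fin (n + 1) → Fin (n + 1) → ℝ)).det|) =
      (gaussMat n).map (fun B => ‖WithLp.toLp 2 v‖ * |(Matrix.of B).det|) := by
  obtain ⟨f, hf1, hfv, hfm⟩ := exists_gaussVec_rotation v
  have hpres : MeasurePreserving (fun (R : Fin n → Fin (n + 1) → ℝ) (i : Fin n) =>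
      (fun j : Fin n => f (R i) j.succ)) (Measure.pi fun _ : Fin n => gaussVec (n + 1))
      (gaussMat n) :=
    measurePreserving_pi (fun _ => gaussVec (n + 1)) (fun _ => gaussVec n)
      (fun _ => (measurePreserving_tail_gaussVec n).comp hfm)
  rw [← hpres.map_eq, Measure.map_map ((measurable_abs_det n).const_mul _) hpres.measurable]
  congr 1
  ext R
  rw [← abs_det_map f hf1]
  have : (fun i => f ((Fin.cons v R : Fin (n + 1) → Fin (n + 1) → ℝ) i)) =
      (Fin.cons (Pi.single 0 ‖WithLp.toLp 2 v‖) (fun i => f (R i)) :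
        Fin (n + 1) → Fin (n + 1) → ℝ) := by
    ext i
    refine Fin.cases ?_ (fun i => ?_) i
    · simp [hfv]
    · simp
  rw [this, det_cons_single, abs_mul, abs_norm]
  rfl

/-- One step of the recursion for the law of the absolute determinant. -/
lemma lintegral_abs_det_succ {n : ℕ} {g : ℝ → ENNReal} (hg : Measurable g) :
    ∫⁻ M, g |(Matrix.of M).det| ∂gaussMat (n + 1) =
      ∫⁻ v, ∫⁻ B, g (‖v‖ * |(Matrix.of B).det|) ∂gaussMat n
        ∂stdGaussian (EuclideanSpace ℝ (Fin (n + 1))) := by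
  have h := (measurePreserving_piFinSuccAbove (α := fun _ : Fin (n + 1) => Fin (n + 1) → ℝ)
    (fun _ => gaussVec (n + 1)) 0).symm
  have hm := measurable_abs_det (n + 1)
  have hgm : Measurable fun M : Fin (n + 1) → Fin (n + 1) → ℝ => g |(Matrix.of M).det| :=
    hg.comp hm
  rw [gaussMat, ← h.lintegral_comp hgm, lintegral_prod
      (fun a => g |(Matrix.of ((MeasurableEquiv.piFinSuccAbove
        (fun _ : Fin (n + 1) => Fin (n + 1) → ℝ) 0).symm a)).det|)
      (hgm.comp h.measurable).aemeasurable]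
  have hmm : Measurable fun p : EuclideanSpace ℝ (Fin (n + 1)) × (Fin n → Fin n → ℝ) =>
      g (‖p.1‖ * |(Matrix.of p.2).det|) :=
    hg.comp ((measurable_norm.comp measurable_fst).mul
      ((measurable_abs_det n).comp measurable_snd))
  rw [← (measurePreserving_toLp_gaussVec (n + 1)).lintegral_comp
    (Measurable.lintegral_prod_right' hmm)]
  refine lintegral_congr fun v => ?_
  have h1 := map_abs_det_cons v
  have hcons : Measurable fun R : Fin n → Fin (n + 1) → ℝ =>
      |(Matrix.of (Fin.cons v R : Fin (n + 1) → Fin (n + 1) → ℝ)).det| := by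
    refine hm.comp ?_
    refine measurable_pi_lambda _ fun i => ?_
    refine Fin.cases ?_ (fun i => ?_) i
    · simp
    · simpa using measurable_pi_apply i
  have h2 := congrArg (fun μ => ∫⁻ x, g x ∂μ) h1
  rw [lintegral_map hg hcons, lintegral_map hg ((measurable_abs_det n).const_mul _)] at h2
  have hins : ∀ R : Fin n → Fin (n + 1) → ℝ,
      (MeasurableEquiv.piFinSuccAbove (fun _ : Fin (n + 1) => Fin (n + 1) → ℝ) 0).symm (v, R) =
        Fin.cons v R := fun R => Fin.insertNth_zero' v R
  simp only [hins]
  exact h2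

/-- The absolute determinant of a Gaussian matrix is the product of the length of an independent
Gaussian vector and the absolute determinant of a smaller Gaussian matrix, in law. -/
lemma map_abs_det_succ (n : ℕ) :
    (gaussMat (n + 1)).map (fun M => |(Matrix.of M).det|) =
      ((stdGaussian (EuclideanSpace ℝ (Fin (n + 1)))).prod (gaussMat n)).map
        (fun p => ‖p.1‖ * |(Matrix.of p.2).det|) := by
  have hmm : Measurable fun p : EuclideanSpace ℝ (Fin (n + 1)) × (Fin n → Fin n → ℝ) =>
      ‖p.1‖ * |(Matrix.of p.2).det| :=
    (measurable_norm.comp measurable_fst).mul ((measurable_abs_det n).comp measurable_snd)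
  refine Measure.ext_of_lintegral _ fun g hg => ?_
  rw [lintegral_map hg (measurable_abs_det _), lintegral_abs_det_succ hg, lintegral_map hg hmm,
    lintegral_prod
      (fun p : EuclideanSpace ℝ (Fin (n + 1)) × (Fin n → Fin n → ℝ) =>
        g (‖p.1‖ * |(Matrix.of p.2).det|)) (hg.comp hmm).aemeasurable]

/-- The Mellin transform of the absolute determinant of a Gaussian matrix on the imaginary axis is
the product of those of the lengths of Gaussian vectors. -/
lemma integral_abs_det_cpow (n : ℕ) (z : ℂ) :
    ∫ M, ((|(Matrix.of M).det| : ℝ) : ℂ) ^ z ∂gaussMat n =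
      ∏ k ∈ Finset.range n, ∫ v, ((‖v‖ : ℝ) : ℂ) ^ z
        ∂stdGaussian (EuclideanSpace ℝ (Fin (k + 1))) := by
  induction n with
  | zero => simp
  | succ n ih =>
    have hmm : Measurable fun p : EuclideanSpace ℝ (Fin (n + 1)) × (Fin n → Fin n → ℝ) =>
        ‖p.1‖ * |(Matrix.of p.2).det| :=
      (measurable_norm.comp measurable_fst).mul ((measurable_abs_det n).comp measurable_snd)
    have hpow : Measurable fun x : ℝ => (x : ℂ) ^ z := Complex.measurable_ofReal.pow_const z
    rw [← integral_map (φ := fun M => |(Matrix.of M).det|) (f := fun x : ℝ => (x : ℂ) ^ z)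
      (measurable_abs_det _).aemeasurable hpow.aestronglyMeasurable, map_abs_det_succ,
      integral_map hmm.aemeasurable hpow.aestronglyMeasurable, Finset.prod_range_succ, ← ih,
      mul_comm, ← integral_prod_mul]
    refine integral_congr_ae (Filter.Eventually.of_forall fun p => ?_)
    simp only
    push_cast
    rw [← Complex.mul_cpow_ofReal_nonneg (norm_nonneg _) (abs_nonneg _)]

/-- A Gaussian matrix is almost surely invertible. -/
lemma ae_det_ne_zero (n : ℕ) : ∀ᵐ M ∂gaussMat n, |(Matrix.of M).det| ≠ 0 := by
  induction n with
  | zero => simp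
  | succ n ih =>
    have hmm : Measurable fun p : EuclideanSpace ℝ (Fin (n + 1)) × (Fin n → Fin n → ℝ) =>
        ‖p.1‖ * |(Matrix.of p.2).det| :=
      (measurable_norm.comp measurable_fst).mul ((measurable_abs_det n).comp measurable_snd)
    have hs : MeasurableSet {x : ℝ | x ≠ 0} := (measurableSet_singleton 0).compl
    have key : ∀ᵐ x ∂(gaussMat (n + 1)).map (fun M => |(Matrix.of M).det|), x ≠ 0 := by
      rw [map_abs_det_succ, ae_map_iff hmm.aemeasurable hs]
      have h1 : ∀ᵐ v ∂stdGaussian (EuclideanSpace ℝ (Fin (n + 1))), v ≠ 0 := by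
        have h2 : ∀ᵐ x ∂gaussVec (n + 1), x 0 ≠ 0 := by
          have h3 : MeasurePreserving (fun x : Fin (n + 1) → ℝ => x 0) (gaussVec (n + 1))
            (gaussianReal 0 1) := measurePreserving_eval (fun _ => gaussianReal 0 1) 0
          have h4 : ∀ᵐ x ∂gaussianReal 0 1, x ≠ 0 := by
            have := nullSingletonClass_gaussianReal (μ := 0) (v := 1) one_ne_zero
            exact Measure.ae_ne _ 0
          exact h3.quasiMeasurePreserving.ae h4
        filter_upwards [(measurePreserving_ofLp_stdGaussian (n + 1)).quasiMeasurePreserving.ae h2]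
          with v hv h0
        simp [h0] at hv
      have h5 : ∀ᵐ p ∂(stdGaussian (EuclideanSpace ℝ (Fin (n + 1)))).prod (gaussMat n), p.1 ≠ 0 := Measure.quasiMeasurePreserving_fst
        (μ := stdGaussian (EuclideanSpace ℝ (Fin (n + 1)))) (ν := gaussMat n) |>.ae h1
      have h6 : ∀ᵐ p ∂(stdGaussian (EuclideanSpace ℝ (Fin (n + 1)))).prod (gaussMat n),
          |(Matrix.of p.2).det| ≠ 0 := Measure.quasiMeasurePreserving_snd
        (μ := stdGaussian (EuclideanSpace ℝ (Fin (n + 1)))) (ν := gaussMat n) |>.ae ih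
      exact (h5.and h6).mono fun _ hp => mul_ne_zero (norm_ne_zero_iff.2 hp.1) hp.2
    exact (ae_map_iff (measurable_abs_det _).aemeasurable hs).1 key

/-- The law of a matrix with independent standard Gaussian entries. -/
lemma hasLaw_gaussMat {Ω : Type*} [MeasurableSpace Ω] {P : Measure Ω} {n : ℕ}
    [IsProbabilityMeasure P] {A : Ω → Matrix (Fin n) (Fin n) ℝ}
    (hA : ∀ i j, HasLaw (fun ω => A ω i j) (gaussianReal 0 1) P)
    (hind : iIndepFun (fun (p : Fin n × Fin n) (ω : Ω) => A ω p.1 p.2) P) :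
    HasLaw (fun ω => fun i j => A ω i j) (gaussMat n) P := by
  have h1 := hind.hasLaw_infinitePi (μ := fun _ => gaussianReal 0 1) (fun p : Fin n × Fin n => hA p.1 p.2)
    (aemeasurable_pi_lambda _ fun p : Fin n × Fin n => (hA p.1 p.2).aemeasurable)
  have h2 : HasLaw (MeasurableEquiv.curry (Fin n) (Fin n) ℝ) (gaussMat n)
      (Measure.infinitePi fun _ : Fin n × Fin n => gaussianReal 0 1) := by
    refine ⟨(MeasurableEquiv.measurable _).aemeasurable, ?_⟩
    have := Measure.infinitePi_map_curry (fun (_ _ : Fin n) => gaussianReal 0 1)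
    rw [this]
    simp only [Measure.infinitePi_eq_pi]
    rfl
  exact h2.comp h1

/-- The density of the standard Gaussian measure. -/
lemma stdGaussian_eq_withDensity (E : Type*) [NormedAddCommGroup E] [InnerProductSpace ℝ E]
    [FiniteDimensional ℝ E] [MeasurableSpace E] [BorelSpace E] :
    stdGaussian E = (volume : Measure E).withDensity (fun x => ENNReal.ofReal
      ((2 * Real.pi) ^ (-(Module.finrank ℝ E : ℝ) / 2) * Real.exp (-‖x‖ ^ 2 / 2))) := by
  set c : ℝ := (2 * Real.pi) ^ (-(Module.finrank ℝ E : ℝ) / 2) with hc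
  have hc0 : 0 < c := by positivity
  have hint : Integrable (fun x : E => c * Real.exp (-‖x‖ ^ 2 / 2)) := by
    have h := GaussianFourier.integrable_cexp_neg_mul_sq_norm_add (b := 1 / 2) (V := E)
      (by norm_num) 0 0
    have h2 := (h.norm).const_mul c
    refine h2.congr (Filter.Eventually.of_forall fun x => ?_)
    simp only [zero_mul, add_zero]
    rw [show (-(1 / 2 : ℂ) * (‖x‖ : ℂ) ^ 2) = ((-‖x‖ ^ 2 / 2 : ℝ) : ℂ) by push_cast; ring,
      Complex.norm_exp_ofReal]
  have : IsFiniteMeasure ((volume : Measure E).withDensity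
      (fun x => ENNReal.ofReal (c * Real.exp (-‖x‖ ^ 2 / 2)))) :=
    isFiniteMeasure_withDensity_ofReal hint.2
  refine Measure.ext_of_charFun ?_
  ext t
  rw [charFun_stdGaussian, charFun_apply,
    integral_withDensity_eq_integral_toReal_smul (by fun_prop) (by simp)]
  have h := GaussianFourier.integral_cexp_neg_mul_sq_norm_add (b := 1 / 2) (V := E)
      (by norm_num) Complex.I t
  have h3 : ∀ x : E, (ENNReal.ofReal (c * Real.exp (-‖x‖ ^ 2 / 2))).toReal •
      Complex.exp (inner ℝ x t * Complex.I) =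
      (c : ℂ) * Complex.exp (-(1 / 2) * ‖x‖ ^ 2 + Complex.I * inner ℝ t x) := by
    intro x
    rw [ENNReal.toReal_ofReal (by positivity), Complex.real_smul, Complex.exp_add,
      real_inner_comm]
    push_cast
    rw [mul_assoc, ← Complex.exp_add, ← Complex.exp_add]
    congr 2
    ring
  simp_rw [h3]
  rw [integral_const_mul, h, hc]
  have h4 : ((Real.pi : ℂ) / (1 / 2)) ^ ((Module.finrank ℝ E : ℂ) / 2) =
      (((2 * Real.pi) ^ ((Module.finrank ℝ E : ℝ) / 2) : ℝ) : ℂ) := by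
    rw [Complex.ofReal_cpow (by positivity)]
    push_cast
    congr 1
    ring
  rw [h4, ← mul_assoc, ← Complex.ofReal_mul, ← Real.rpow_add (by positivity),
    show -(Module.finrank ℝ E : ℝ) / 2 + (Module.finrank ℝ E : ℝ) / 2 = 0 by ring, Real.rpow_zero]
  simp only [Complex.ofReal_one, one_mul]
  congr 1
  rw [Complex.I_sq]
  ring

lemma integral_cpow_mul_exp_neg_sq {a : ℂ} (ha : 0 < a.re) :
    ∫ y in Set.Ioi (0 : ℝ), (y : ℂ) ^ (a - 1) * Complex.exp (-y ^ 2 / 2) =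
      1 / 2 * (2 ^ (a / 2) * Complex.Gamma (a / 2)) := by
  have h := Complex.integral_cpow_mul_exp_neg_mul_Ioi (a := a / 2) (r := 1 / 2)
    (by simpa using ha) (by norm_num)
  rw [← integral_comp_rpow_Ioi_of_pos (p := 2) (by norm_num)] at h
  have h2 : (1 / ((1 / 2 : ℝ) : ℂ)) = 2 := by push_cast; norm_num
  rw [h2] at h
  rw [← h, ← integral_const_mul]
  refine setIntegral_congr_fun measurableSet_Ioi fun y hy => ?_
  have hy : 0 < y := hy
  have hyc : (y : ℂ) ≠ 0 := by exact_mod_cast hy.ne'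
  rw [Real.rpow_two, show (2 : ℝ) - 1 = 1 by norm_num, Real.rpow_one, Complex.real_smul]
  push_cast
  have h3 : ((y : ℂ) ^ 2) ^ (a / 2 - 1) = (y : ℂ) ^ (a - 2) := by
    rw [sq, Complex.mul_cpow_ofReal_nonneg hy.le hy.le, ← Complex.cpow_add _ _ hyc]
    congr 1
    ring
  rw [h3, show a - 1 = (a - 2) + 1 by ring, Complex.cpow_add _ _ hyc, Complex.cpow_one]
  rw [show (-(1 / 2 * (y : ℂ) ^ 2)) = -y ^ 2 / 2 by ring]
  ring

/-- The Mellin transform of the length of a standard Gaussian vector. -/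
lemma integral_norm_cpow_stdGaussian (d : ℕ) {z : ℂ} (hz : -((d : ℝ) + 1) < z.re) :
    ∫ v, ((‖v‖ : ℝ) : ℂ) ^ z ∂stdGaussian (EuclideanSpace ℝ (Fin (d + 1))) =
      2 ^ (z / 2) * Complex.Gamma (((d : ℂ) + 1 + z) / 2) / Complex.Gamma (((d : ℂ) + 1) / 2) := by
  obtain ⟨K, hK⟩ : ∃ K : ℂ, ∀ w : ℂ, -((d : ℝ) + 1) < w.re →
      ∫ v, ((‖v‖ : ℝ) : ℂ) ^ w ∂stdGaussian (EuclideanSpace ℝ (Fin (d + 1))) =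
        K * (1 / 2 * (2 ^ (((d : ℂ) + 1 + w) / 2) * Complex.Gamma (((d : ℂ) + 1 + w) / 2))) := by
    set c : ℝ := (2 * Real.pi) ^
      (-(Module.finrank ℝ (EuclideanSpace ℝ (Fin (d + 1))) : ℝ) / 2) with hc
    have hc0 : 0 < c := by positivity
    refine ⟨(c : ℂ) * ((d + 1 : ℕ) : ℂ) * (((volume : Measure (EuclideanSpace ℝ (Fin (d + 1)))).real
      (Metric.ball 0 1) : ℝ) : ℂ), fun w hw => ?_⟩
    rw [stdGaussian_eq_withDensity, ← hc,
      integral_withDensity_eq_integral_toReal_smul (by fun_prop) (by simp)]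
    have h := integral_fun_norm_addHaar (volume : Measure (EuclideanSpace ℝ (Fin (d + 1))))
      (fun y : ℝ => (c * Real.exp (-y ^ 2 / 2)) • ((y : ℂ) ^ w))
    have h1 : ∀ v : EuclideanSpace ℝ (Fin (d + 1)),
        (ENNReal.ofReal (c * Real.exp (-‖v‖ ^ 2 / 2))).toReal • ((‖v‖ : ℝ) : ℂ) ^ w =
        (c * Real.exp (-‖v‖ ^ 2 / 2)) • (((‖v‖ : ℝ) : ℂ) ^ w) := fun v => by
      rw [ENNReal.toReal_ofReal (by positivity)]
    simp_rw [h1]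
    rw [h, ← integral_cpow_mul_exp_neg_sq (by simpa using by linarith)]
    simp only [finrank_euclideanSpace, Fintype.card_fin, Complex.real_smul, nsmul_eq_mul,
      add_tsub_cancel_right]
    have h5 : ∫ y in Set.Ioi (0 : ℝ), ((y ^ d : ℝ) : ℂ) *
        (((c * Real.exp (-y ^ 2 / 2) : ℝ) : ℂ) * (y : ℂ) ^ w) =
        c * ∫ y in Set.Ioi (0 : ℝ), (y : ℂ) ^ ((d : ℂ) + 1 + w - 1) *
          Complex.exp (-y ^ 2 / 2) := by
      rw [← integral_const_mul]
      refine setIntegral_congr_fun measurableSet_Ioi fun y hy => ?_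
      have hyc : (y : ℂ) ≠ 0 := by exact_mod_cast (show 0 < y from hy).ne'
      rw [show (d : ℂ) + 1 + w - 1 = d + w by ring, Complex.cpow_add _ _ hyc,
        Complex.cpow_natCast]
      push_cast
      ring
    rw [h5]
    ring
  have h0 := hK 0 (by rw [Complex.zero_re]; linarith [(Nat.cast_nonneg d : (0 : ℝ) ≤ d)])
  rw [hK z hz]
  simp only [Complex.cpow_zero, add_zero, integral_const, probReal_univ, one_smul] at h0
  have hG : Complex.Gamma (((d : ℂ) + 1) / 2) ≠ 0 := by
    refine Complex.Gamma_ne_zero_of_re_pos ?_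
    have : (((d : ℂ) + 1) / 2).re = ((d : ℝ) + 1) / 2 := by simp
    rw [this]
    positivity
  rw [eq_div_iff hG, show ((d : ℂ) + 1 + z) / 2 = ((d : ℂ) + 1) / 2 + z / 2 by ring,
    Complex.cpow_add _ _ two_ne_zero]
  linear_combination (-2 ^ (z / 2) * Complex.Gamma (((d : ℂ) + 1) / 2 + z / 2)) * h0

lemma gaussianPDFReal_eq_integral {ε : NNReal} (hε : ε ≠ 0) (x y : ℝ) :
    ((gaussianPDFReal x ε y : ℝ) : ℂ) = (1 / (2 * Real.pi)) *
      ∫ t : ℝ, Complex.exp (x * t * Complex.I) *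
        (Complex.exp (-(t * y * Complex.I)) * Complex.exp (-ε * t ^ 2 / 2)) := by
  have hε0 : (0 : ℝ) < ε := by positivity
  have h := fourierIntegral_gaussian (b := ((ε / 2 : ℝ) : ℂ))
    (by rw [Complex.ofReal_re]; positivity) ((x - y : ℝ) : ℂ)
  have h1 : ∀ t : ℝ, Complex.exp (x * t * Complex.I) *
        (Complex.exp (-(t * y * Complex.I)) * Complex.exp (-ε * t ^ 2 / 2)) =
      Complex.exp (Complex.I * ((x - y : ℝ) : ℂ) * t) *
        Complex.exp (-((ε / 2 : ℝ) : ℂ) * t ^ 2) := by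
    intro t
    rw [← Complex.exp_add, ← Complex.exp_add, ← Complex.exp_add]
    congr 1
    push_cast
    ring
  simp_rw [h1]
  rw [h, gaussianPDFReal]
  have h2 : ((Real.pi : ℂ) / ((ε / 2 : ℝ) : ℂ)) ^ (1 / 2 : ℂ) =
      ((Real.sqrt (Real.pi / (ε / 2)) : ℝ) : ℂ) := by
    rw [Real.sqrt_eq_rpow, Complex.ofReal_cpow (by positivity)]
    push_cast
    rfl
  rw [h2]
  have h3 : Real.sqrt (Real.pi / (ε / 2)) = 2 * Real.pi * (Real.sqrt (2 * Real.pi * ε))⁻¹ := by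
    rw [← div_eq_mul_inv, eq_div_iff (by positivity), ← Real.sqrt_mul (by positivity)]
    rw [show Real.pi / (ε / 2) * (2 * Real.pi * ε) = (2 * Real.pi) ^ 2 by field_simp]
    exact Real.sqrt_sq (by positivity)
  rw [h3]
  have hpi : (Real.pi : ℂ) ≠ 0 := by exact_mod_cast Real.pi_ne_zero
  have hεc : ((ε : ℝ) : ℂ) ≠ 0 := by exact_mod_cast hε0.ne'
  have hs : ((Real.sqrt (2 * Real.pi * ε) : ℝ) : ℂ) ≠ 0 := by
    exact_mod_cast (Real.sqrt_pos.2 (by positivity)).ne'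
  have hexp : Complex.exp (-((x - y : ℝ) : ℂ) ^ 2 / (4 * ((ε / 2 : ℝ) : ℂ))) =
      ((Real.exp (-(y - x) ^ 2 / (2 * ε)) : ℝ) : ℂ) := by
    push_cast
    congr 1
    field_simp
    ring
  rw [hexp, Complex.ofReal_mul, Complex.ofReal_mul, Complex.ofReal_inv, Complex.ofReal_mul]
  push_cast
  field_simp

lemma norm_setIntegral_exp_le {a b t : ℝ} (hab : a ≤ b) (ht : t ≠ 0) :
    ‖∫ y in Set.Icc a b, Complex.exp (-(t * y * Complex.I))‖ ≤ 2 / |t| := by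
  rw [integral_Icc_eq_integral_Ioc, ← intervalIntegral.integral_of_le hab]
  have h1 : ∀ y : ℝ, Complex.exp (-(t * y * Complex.I)) =
      Complex.exp ((-(t * Complex.I)) * y) := fun y => by congr 1; ring
  have hc : -(t * Complex.I) ≠ 0 := by simp [ht]
  simp_rw [h1]
  rw [integral_exp_mul_complex hc, norm_div]
  have h2 : ∀ s : ℝ, ‖Complex.exp (-(t * Complex.I) * s)‖ = 1 := fun s => by
    rw [show -(t * Complex.I) * s = ((-(t * s) : ℝ) : ℂ) * Complex.I by push_cast; ring,
      Complex.norm_exp_ofReal_mul_I]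
  have h3 : ‖-(t * Complex.I)‖ = |t| := by simp
  rw [h3]
  gcongr
  refine (norm_sub_le _ _).trans ?_
  rw [h2, h2]
  norm_num

/-- Mass of an interval under a Gaussian smoothing of a measure, in terms of the
characteristic function. -/
lemma integral_gaussianReal_Icc_eq (μ : Measure ℝ) [IsProbabilityMeasure μ] {ε : NNReal}
    (hε : ε ≠ 0) (a b : ℝ) :
    ((∫ x, (gaussianReal x ε).real (Set.Icc a b) ∂μ : ℝ) : ℂ) = (1 / (2 * Real.pi)) *
      ∫ t : ℝ, (∫ y in Set.Icc a b, Complex.exp (-(t * y * Complex.I))) *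
        (Complex.exp (-ε * t ^ 2 / 2) * charFun μ t) := by
  have hε0 : (0 : ℝ) < ε := by positivity
  set W : ℝ → ℂ := fun t => Complex.exp (-ε * t ^ 2 / 2) with hW
  set H : ℝ × ℝ → ℂ := fun p => Complex.exp (-(p.2 * p.1 * Complex.I)) * W p.2 with hH
  set ρ : Measure (ℝ × ℝ) := (volume.restrict (Set.Icc a b)).prod volume with hρ
  have hunit : ∀ s : ℝ, ‖Complex.exp (s * Complex.I)‖ = 1 := Complex.norm_exp_ofReal_mul_I
  have hWint : Integrable W := by
    have := integrable_cexp_neg_mul_sq (b := ((ε / 2 : ℝ) : ℂ))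
      (by rw [Complex.ofReal_re]; positivity)
    refine this.congr (Filter.Eventually.of_forall fun t => ?_)
    simp only [hW]
    congr 1
    push_cast
    ring
  have hWp : Integrable (fun p : ℝ × ℝ => W p.2) ρ := by
    have := (integrable_const (1 : ℂ) (μ := volume.restrict (Set.Icc a b))).mul_prod hWint
    simpa using this
  have hHint : Integrable H ρ := by
    refine hWp.bdd_mul (c := 1) (by fun_prop) (Filter.Eventually.of_forall fun p => ?_)
    rw [show -((p.2 : ℂ) * p.1 * Complex.I) = ((-(p.2 * p.1) : ℝ) : ℂ) * Complex.I by
      push_cast; ring, hunit]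
  have hmul : ∀ x : ℝ, Integrable
      (fun p : ℝ × ℝ => Complex.exp (x * p.2 * Complex.I) * H p) ρ := fun x => by
    refine hHint.bdd_mul (c := 1) (by fun_prop) (Filter.Eventually.of_forall fun p => ?_)
    rw [← Complex.ofReal_mul, hunit]
  have hG : ∀ x : ℝ, (((gaussianReal x ε).real (Set.Icc a b) : ℝ) : ℂ) =
      (1 / (2 * Real.pi)) * ∫ p, Complex.exp (x * p.2 * Complex.I) * H p ∂ρ := by
    intro x
    rw [measureReal_def, gaussianReal_apply_eq_integral x hε, ENNReal.toReal_ofReal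
      (integral_nonneg fun y => gaussianPDFReal_nonneg _ _ _), ← integral_complex_ofReal,
      integral_prod _ (hmul x), ← integral_const_mul]
    refine integral_congr_ae (Filter.Eventually.of_forall fun y => ?_)
    exact gaussianPDFReal_eq_integral hε x y
  have htriple : Integrable
      (fun q : ℝ × (ℝ × ℝ) => Complex.exp (q.1 * q.2.2 * Complex.I) * H q.2) (μ.prod ρ) := by
    have h1 : Integrable (fun q : ℝ × (ℝ × ℝ) => H q.2) (μ.prod ρ) := by
      simpa using (integrable_const (1 : ℂ) (μ := μ)).mul_prod hHint
    refine h1.bdd_mul (c := 1) (by fun_prop) (Filter.Eventually.of_forall fun q => ?_)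
    rw [← Complex.ofReal_mul, hunit]
  have hmeasφ : Measurable (charFun μ) := measurable_charFun
  have hpair : Integrable (fun p : ℝ × ℝ => H p * charFun μ p.2) ρ := by
    have h1 := hHint.bdd_mul (c := 1) (f := fun p : ℝ × ℝ => charFun μ p.2)
      (hmeasφ.comp measurable_snd).aestronglyMeasurable
      (Filter.Eventually.of_forall fun p => norm_charFun_le_one _)
    refine h1.congr (Filter.Eventually.of_forall fun p => mul_comm _ _)
  rw [← integral_complex_ofReal]
  simp_rw [hG]
  rw [integral_const_mul]
  congr 1
  rw [integral_integral_swap htriple]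
  have h2 : ∀ p : ℝ × ℝ, ∫ x, Complex.exp (x * p.2 * Complex.I) * H p ∂μ =
      H p * charFun μ p.2 := by
    intro p
    rw [integral_mul_const, charFun_apply_real, mul_comm]
    congr 1
    refine integral_congr_ae (Filter.Eventually.of_forall fun x => ?_)
    simp only
    congr 1
    ring
  simp_rw [h2]
  rw [hρ, integral_prod_symm _ hpair]
  refine integral_congr_ae (Filter.Eventually.of_forall fun t => ?_)
  simp only [hH]
  rw [← integral_mul_const]
  refine integral_congr_ae (Filter.Eventually.of_forall fun y => ?_)
  simp only
  ring

lemma abs_integral_gaussianReal_Icc_sub_le (μ ν : Measure ℝ) [IsProbabilityMeasure μ]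
    [IsProbabilityMeasure ν] (hint : Integrable fun t => ‖charFun μ t - charFun ν t‖ / |t|)
    {ε : NNReal} (hε : ε ≠ 0) {a b : ℝ} (hab : a ≤ b) :
    |∫ x, (gaussianReal x ε).real (Set.Icc a b) ∂μ -
        ∫ x, (gaussianReal x ε).real (Set.Icc a b) ∂ν| ≤
      (1 / Real.pi) * ∫ t, ‖charFun μ t - charFun ν t‖ / |t| := by
  have hε0 : (0 : ℝ) < ε := by positivity
  have hWint : Integrable (fun t : ℝ => Complex.exp (-ε * t ^ 2 / 2)) := by
    have := integrable_cexp_neg_mul_sq (b := ((ε / 2 : ℝ) : ℂ))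
      (by rw [Complex.ofReal_re]; positivity)
    refine this.congr (Filter.Eventually.of_forall fun t => ?_)
    simp only
    congr 1
    push_cast
    ring
  have hWnorm : ∀ t : ℝ, ‖Complex.exp (-ε * t ^ 2 / 2)‖ ≤ 1 := fun t => by
    rw [show -(ε : ℂ) * t ^ 2 / 2 = ((-ε * t ^ 2 / 2 : ℝ) : ℂ) by push_cast; ring,
      Complex.norm_exp_ofReal, Real.exp_le_one_iff]
    have := mul_nonneg hε0.le (sq_nonneg t)
    linarith
  have hmeas : StronglyMeasurable
      (fun t : ℝ => ∫ y in Set.Icc a b, Complex.exp (-(t * y * Complex.I))) := by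
    refine StronglyMeasurable.integral_prod_right
      (f := fun t y : ℝ => Complex.exp (-(t * y * Complex.I))) ?_
    refine Continuous.stronglyMeasurable ?_
    fun_prop
  have hE : ∀ κ : Measure ℝ, [IsProbabilityMeasure κ] → Integrable
      (fun t : ℝ => (∫ y in Set.Icc a b, Complex.exp (-(t * y * Complex.I))) *
        (Complex.exp (-ε * t ^ 2 / 2) * charFun κ t)) := by
    intro κ _
    refine Integrable.bdd_mul (c := b - a) ?_ hmeas.aestronglyMeasurable
      (Filter.Eventually.of_forall fun t => ?_)
    · refine (hWint.bdd_mul (c := 1) (f := charFun κ) measurable_charFun.aestronglyMeasurable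
        (Filter.Eventually.of_forall fun p => norm_charFun_le_one _)).congr
        (Filter.Eventually.of_forall fun t => mul_comm _ _)
    · refine (norm_setIntegral_le_of_norm_le_const (C := 1) (by simp) fun y _ => ?_).trans ?_
      · rw [show -((t : ℂ) * y * Complex.I) = ((-(t * y) : ℝ) : ℂ) * Complex.I by
          push_cast; ring, Complex.norm_exp_ofReal_mul_I]
      · simp [hab]
  have hkey : (((∫ x, (gaussianReal x ε).real (Set.Icc a b) ∂μ -
        ∫ x, (gaussianReal x ε).real (Set.Icc a b) ∂ν : ℝ)) : ℂ) = (1 / (2 * Real.pi)) *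
      ∫ t : ℝ, (∫ y in Set.Icc a b, Complex.exp (-(t * y * Complex.I))) *
        (Complex.exp (-ε * t ^ 2 / 2) * (charFun μ t - charFun ν t)) := by
    rw [Complex.ofReal_sub, integral_gaussianReal_Icc_eq μ hε, integral_gaussianReal_Icc_eq ν hε,
      ← mul_sub, ← integral_sub (hE μ) (hE ν)]
    congr 2
    ext t
    ring
  rw [← Real.norm_eq_abs, ← Complex.norm_real, hkey, norm_mul]
  have hpi := Real.pi_pos
  have h1 : ‖(1 / (2 * Real.pi) : ℂ)‖ = 1 / (2 * Real.pi) := by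
    rw [show (1 / (2 * Real.pi) : ℂ) = ((1 / (2 * Real.pi) : ℝ) : ℂ) by push_cast; ring,
      Complex.norm_real, Real.norm_of_nonneg (by positivity)]
  rw [h1]
  have h2 : ‖∫ t : ℝ, (∫ y in Set.Icc a b, Complex.exp (-(t * y * Complex.I))) *
        (Complex.exp (-ε * t ^ 2 / 2) * (charFun μ t - charFun ν t))‖ ≤
      ∫ t, 2 * (‖charFun μ t - charFun ν t‖ / |t|) := by
    refine norm_integral_le_of_norm_le (hint.const_mul 2) ?_
    filter_upwards [Measure.ae_ne volume (0 : ℝ)] with t ht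
    rw [norm_mul, norm_mul]
    have h3 := norm_setIntegral_exp_le hab ht
    calc _ ≤ 2 / |t| * (1 * ‖charFun μ t - charFun ν t‖) := by
          gcongr
          exact hWnorm t
      _ = _ := by ring
  rw [integral_const_mul] at h2
  calc _ ≤ 1 / (2 * Real.pi) * (2 * ∫ t, ‖charFun μ t - charFun ν t‖ / |t|) := by gcongr
    _ = _ := by field_simp

open Filter Topology in
lemma tendsto_gaussianReal_Icc {a b x : ℝ} (hxa : x ≠ a) (hxb : x ≠ b) :
    Tendsto (fun k : ℕ => (gaussianReal x (1 / ((k : NNReal) + 1) ^ 2)).real (Set.Icc a b)) atTop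
      (𝓝 ((Set.Icc a b).indicator (fun _ => (1 : ℝ)) x)) := by
  have hlim : Tendsto (fun k : ℕ => (1 : ℝ) / ((k : ℝ) + 1)) atTop (𝓝 0) :=
    tendsto_one_div_add_atTop_nhds_zero_nat
  have heq : ∀ k : ℕ, (gaussianReal x (1 / ((k : NNReal) + 1) ^ 2)).real (Set.Icc a b) =
      ∫ z, (Set.Icc a b).indicator (fun _ => (1 : ℝ)) (x + 1 / ((k : ℝ) + 1) * z)
        ∂gaussianReal 0 1 := by
    intro k
    have hmap : (gaussianReal 0 1).map (fun z => x + 1 / ((k : ℝ) + 1) * z) =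
        gaussianReal x (1 / ((k : NNReal) + 1) ^ 2) := by
      have h1 := gaussianReal_map_const_mul (μ := 0) (v := 1) (1 / ((k : ℝ) + 1))
      have h2 := congrArg (Measure.map (x + ·)) h1
      rw [Measure.map_map (by fun_prop) (by fun_prop), gaussianReal_map_const_add] at h2
      convert h2 using 2
      · rfl
      · ring
      · refine NNReal.eq ?_
        simp
    rw [← hmap, ← integral_map (φ := fun z => x + 1 / ((k : ℝ) + 1) * z)
      (f := (Set.Icc a b).indicator (fun _ => (1 : ℝ))) (by fun_prop)
      ((measurable_const.indicator measurableSet_Icc).aestronglyMeasurable)]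
    exact (integral_indicator_one measurableSet_Icc).symm
  simp_rw [heq]
  have hc : (Set.Icc a b).indicator (fun _ => (1 : ℝ)) x =
      ∫ _, (Set.Icc a b).indicator (fun _ => (1 : ℝ)) x ∂gaussianReal 0 1 := by simp
  rw [hc]
  refine tendsto_integral_of_dominated_convergence (fun _ => 1) (fun k => ?_)
    (integrable_const _) (fun k => Eventually.of_forall fun z => ?_)
    (Eventually.of_forall fun z => ?_)
  · exact ((measurable_const.indicator measurableSet_Icc).comp
      (by fun_prop : Measurable fun z : ℝ => x + 1 / ((k : ℝ) + 1) * z)).aestronglyMeasurable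
  · refine (norm_indicator_le_norm_self _ _).trans (by simp)
  · have hz : Tendsto (fun k : ℕ => x + 1 / ((k : ℝ) + 1) * z) atTop (𝓝 x) := by
      simpa using (hlim.mul_const z).const_add x
    have hcont : ContinuousAt ((Set.Icc a b).indicator (fun _ => (1 : ℝ))) x := by
      by_cases hx : x ∈ Set.Ioo a b
      · refine ContinuousAt.congr (f := fun _ => 1) continuousAt_const ?_
        filter_upwards [Ioo_mem_nhds hx.1 hx.2] with y hy
        rw [Set.indicator_of_mem (Set.Ioo_subset_Icc_self hy)]
      · have hx' : x ∈ (Set.Icc a b)ᶜ := by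
          intro h
          exact hx ⟨lt_of_le_of_ne h.1 hxa.symm, lt_of_le_of_ne h.2 hxb⟩
        refine ContinuousAt.congr (f := fun _ => 0) continuousAt_const ?_
        filter_upwards [isClosed_Icc.isOpen_compl.mem_nhds hx'] with y hy
        rw [Set.indicator_of_notMem hy]
    exact hcont.tendsto.comp hz

open Filter Topology in
lemma tendsto_integral_gaussianReal_Icc (μ : Measure ℝ) [IsProbabilityMeasure μ] {a b : ℝ}
    (ha : μ {a} = 0) (hb : μ {b} = 0) :
    Tendsto (fun k : ℕ => ∫ x, (gaussianReal x (1 / ((k : NNReal) + 1) ^ 2)).real (Set.Icc a b) ∂μ)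
      atTop (𝓝 (μ.real (Set.Icc a b))) := by
  rw [← integral_indicator_one measurableSet_Icc]
  refine tendsto_integral_of_dominated_convergence (fun _ => 1) (fun k => ?_)
    (integrable_const _) (fun k => Eventually.of_forall fun x => ?_) ?_
  · refine (Measurable.ennreal_toReal ?_).aestronglyMeasurable
    exact (Measure.measurable_coe measurableSet_Icc).comp
      (measurable_gaussianReal.comp (by fun_prop : Measurable fun x : ℝ =>
        (x, (1 / ((k : NNReal) + 1) ^ 2 : NNReal))))
  · rw [Real.norm_of_nonneg measureReal_nonneg]
    exact measureReal_le_one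
  · have h1 : ∀ᵐ x ∂μ, x ≠ a := by
      rw [ae_iff]; simpa using ha
    have h2 : ∀ᵐ x ∂μ, x ≠ b := by
      rw [ae_iff]; simpa using hb
    filter_upwards [h1, h2] with x hxa hxb
    exact tendsto_gaussianReal_Icc hxa hxb

open Filter Topology in
/-- The smoothing inequality: the distance between distribution functions is controlled by an
integral of the difference of the characteristic functions. -/
lemma abs_measureReal_Iio_sub_le (μ ν : Measure ℝ) [IsProbabilityMeasure μ]
    [IsProbabilityMeasure ν] (hint : Integrable fun t => ‖charFun μ t - charFun ν t‖ / |t|)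
    (r : ℝ) :
    |μ.real (Set.Iio r) - ν.real (Set.Iio r)| ≤
      (1 / Real.pi) * ∫ t, ‖charFun μ t - charFun ν t‖ / |t| := by
  set K := (1 / Real.pi) * ∫ t, ‖charFun μ t - charFun ν t‖ / |t| with hK
  set S : Set ℝ := {x | μ {x} ≠ 0} ∪ {x | ν {x} ≠ 0} with hS
  have hScount : S.Countable :=
    (Measure.countable_meas_pos_of_disjoint_iUnion (μ := μ) (As := fun x : ℝ => {x})
      (fun x => measurableSet_singleton x) (fun x y h => Set.disjoint_singleton.2 h)).mono
      (fun x hx => pos_iff_ne_zero.2 hx) |>.union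
    ((Measure.countable_meas_pos_of_disjoint_iUnion (μ := ν) (As := fun x : ℝ => {x})
      (fun x => measurableSet_singleton x) (fun x y h => Set.disjoint_singleton.2 h)).mono
      (fun x hx => pos_iff_ne_zero.2 hx))
  have hdense : Dense Sᶜ := hScount.dense_compl ℝ
  have hatoms : ∀ x ∈ Sᶜ, μ {x} = 0 ∧ ν {x} = 0 := by
    intro x hx
    simpa [hS, not_or] using hx
  have hIcc : ∀ a ∈ Sᶜ, ∀ b ∈ Sᶜ, a ≤ b →
      |μ.real (Set.Icc a b) - ν.real (Set.Icc a b)| ≤ K := by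
    intro a ha b hb hab
    have h1 := (tendsto_integral_gaussianReal_Icc μ (hatoms a ha).1 (hatoms b hb).1).sub
      (tendsto_integral_gaussianReal_Icc ν (hatoms a ha).2 (hatoms b hb).2)
    refine le_of_tendsto h1.abs (Eventually.of_forall fun k => ?_)
    exact abs_integral_gaussianReal_Icc_sub_le μ ν hint (by positivity) hab
  obtain ⟨u, hu_mono, hu_mem, hu_lim⟩ := hdense.exists_seq_strictMono_tendsto r
  obtain ⟨l, hl⟩ : ∃ l : ℕ → ℝ, ∀ k : ℕ, l k ∈ Sᶜ ∧ l k ≤ u 0 ∧ l k < -k := by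
    have : ∀ k : ℕ, ∃ x, x ∈ Sᶜ ∧ x ≤ u 0 ∧ x < -(k : ℝ) := by
      intro k
      obtain ⟨x, hx, hx1⟩ := hdense.exists_lt (min (u 0) (-(k : ℝ)))
      exact ⟨x, hx, (hx1.le.trans (min_le_left _ _)), hx1.trans_le (min_le_right _ _)⟩
    choose l hl using this
    exact ⟨l, hl⟩
  have hconv : ∀ κ : Measure ℝ, [IsProbabilityMeasure κ] →
      Tendsto (fun k : ℕ => κ.real (Set.Icc (l k) (u k))) atTop (𝓝 (κ.real (Set.Iio r))) := by
    intro κ _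
    have heq : ∀ s : Set ℝ, MeasurableSet s → κ.real s = ∫ x, s.indicator (fun _ => (1 : ℝ)) x ∂κ :=
      fun s hs => (integral_indicator_one hs).symm
    simp_rw [heq _ measurableSet_Icc, heq _ measurableSet_Iio]
    refine tendsto_integral_of_dominated_convergence (fun _ => 1) (fun k => ?_)
      (integrable_const _) (fun k => Eventually.of_forall fun x => ?_)
      (Eventually.of_forall fun x => ?_)
    · exact (measurable_const.indicator measurableSet_Icc).aestronglyMeasurable
    · exact (norm_indicator_le_norm_self _ _).trans (by simp)
    · refine tendsto_const_nhds.congr' ?_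
      by_cases hx : x < r
      · obtain ⟨N, hN⟩ := exists_nat_gt (-x)
        filter_upwards [hu_lim.eventually (lt_mem_nhds hx), eventually_ge_atTop N] with k hk1 hk2
        have h1 : (N : ℝ) ≤ k := by exact_mod_cast hk2
        have h2 := (hl k).2.2
        rw [Set.indicator_of_mem (show x ∈ Set.Iio r from hx),
          Set.indicator_of_mem (show x ∈ Set.Icc (l k) (u k) from ⟨by linarith, hk1.le⟩)]
      · refine Eventually.of_forall fun k => ?_
        have h1 := (hu_mem k).1
        simp only
        rw [Set.indicator_of_notMem (show x ∉ Set.Iio r from hx),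
          Set.indicator_of_notMem (fun h : x ∈ Set.Icc (l k) (u k) => hx (h.2.trans_lt h1))]
  refine le_of_tendsto ((hconv μ).sub (hconv ν)).abs (Eventually.of_forall fun k => ?_)
  exact hIcc _ (hl k).1 _ (hu_mem k).2 ((hl k).2.1.trans (hu_mono.monotone (Nat.zero_le k)))

/-- The function `1/2 - 1/t + 1/(e^t - 1)` occurring in Binet's formula. -/
noncomputable def binetKernel (t : ℝ) : ℝ := 1 / 2 - 1 / t + 1 / (Real.exp t - 1)

lemma exp_sub_one_pos {t : ℝ} (ht : 0 < t) : 0 < Real.exp t - 1 :=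
  sub_pos.2 (Real.one_lt_exp_iff.2 ht)

lemma binetKernel_nonneg {t : ℝ} (ht : 0 < t) : 0 ≤ binetKernel t := by
  have hmono : MonotoneOn (fun x : ℝ => (x - 2) * Real.exp x + x + 2) (Set.Ici 0) := by
    refine monotoneOn_of_deriv_nonneg (convex_Ici 0) (by fun_prop) (by fun_prop) fun x _ => ?_
    have hd : HasDerivAt (fun x : ℝ => (x - 2) * Real.exp x + x + 2)
        (1 * Real.exp x + (x - 2) * Real.exp x + 1) x := by
      have h1 : HasDerivAt (fun x : ℝ => x - 2) 1 x := (hasDerivAt_id x).sub_const 2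
      exact ((h1.mul (Real.hasDerivAt_exp x)).add (hasDerivAt_id x)).add_const 2
    rw [hd.deriv]
    have h2 : 1 - x ≤ Real.exp (-x) := by linarith [Real.add_one_le_exp (-x)]
    have h3 := mul_le_mul_of_nonneg_left h2 (Real.exp_pos x).le
    rw [← Real.exp_add, add_neg_cancel, Real.exp_zero] at h3
    linarith
  have h := hmono (Set.mem_Ici.2 le_rfl) (Set.mem_Ici.2 ht.le) ht.le
  simp only [Real.exp_zero] at h
  have he := exp_sub_one_pos ht
  have heq : binetKernel t = ((t - 2) * Real.exp t + t + 2) / (2 * t * (Real.exp t - 1)) := by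
    rw [binetKernel]
    field_simp
    ring
  rw [heq]
  exact div_nonneg (by linarith) (by positivity)

lemma binetKernel_le {t : ℝ} (ht : 0 < t) : binetKernel t ≤ t / 4 := by
  have h1 := Real.quadratic_le_exp_of_nonneg ht.le
  have h2 : 1 / (Real.exp t - 1) ≤ 1 / (t + t ^ 2 / 2) :=
    one_div_le_one_div_of_le (by positivity) (by linarith)
  have h3 : 1 / 2 - 1 / t + 1 / (t + t ^ 2 / 2) ≤ t / 4 := by
    have : 1 / 2 - 1 / t + 1 / (t + t ^ 2 / 2) = t / (2 * (2 + t)) := by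
      field_simp
      ring
    rw [this]
    gcongr
    linarith
  rw [binetKernel]
  linarith

lemma binetKernel_le_half {t : ℝ} (ht : 0 < t) : binetKernel t ≤ 1 / 2 := by
  have h1 := Real.add_one_le_exp t
  have h2 : 1 / (Real.exp t - 1) ≤ 1 / t := one_div_le_one_div_of_le ht (by linarith)
  rw [binetKernel]
  linarith

lemma one_div_exp_sub_one_le {t : ℝ} (ht : 0 < t) :
    1 / (Real.exp t - 1) ≤ 1 / t * Real.exp (-(t / 2)) := by
  have h1 : t / 2 ≤ Real.sinh (t / 2) := Real.self_le_sinh_iff.2 (by positivity)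
  have h2 : Real.exp t - 1 = 2 * Real.exp (t / 2) * Real.sinh (t / 2) := by
    rw [Real.sinh_eq, show Real.exp t = Real.exp (t / 2) * Real.exp (t / 2) by
      rw [← Real.exp_add]; ring_nf]
    have : Real.exp (t / 2) * Real.exp (-(t / 2)) = 1 := by rw [← Real.exp_add]; simp
    linear_combination this
  have h3 : t * Real.exp (t / 2) ≤ Real.exp t - 1 := by
    rw [h2]
    nlinarith [Real.exp_pos (t / 2)]
  refine (one_div_le_one_div_of_le (by positivity) h3).trans (le_of_eq ?_)
  rw [Real.exp_neg]
  field_simp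

lemma meanIntegrand_eq (t : ℝ) : meanIntegrand t = binetKernel t * (1 / (Real.exp (t / 2) - 1)) :=
  rfl

lemma varIntegrand_eq (t : ℝ) :
    varIntegrand t = (binetKernel t + 1 / 2) * (t / (Real.exp (t / 2) - 1)) := by
  rw [varIntegrand, binetKernel]
  ring

lemma meanIntegrand_nonneg {t : ℝ} (ht : 0 < t) : 0 ≤ meanIntegrand t :=
  mul_nonneg (binetKernel_nonneg ht) (one_div_nonneg.2 (exp_sub_one_pos (half_pos ht)).le)

lemma meanIntegrand_le {t : ℝ} (ht : 0 < t) :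
    meanIntegrand t ≤ 1 / 2 * Real.exp (-(1 / 4) * t) := by
  have h1 := one_div_exp_sub_one_le (half_pos ht)
  rw [meanIntegrand_eq]
  calc _ ≤ t / 4 * (1 / (t / 2) * Real.exp (-(t / 2 / 2))) :=
        mul_le_mul (binetKernel_le ht) h1
          (one_div_nonneg.2 (exp_sub_one_pos (half_pos ht)).le) (by positivity)
    _ = 1 / 2 * Real.exp (-(1 / 4) * t) := by
        rw [show -(t / 2 / 2) = -(1 / 4) * t by ring]
        field_simp
        norm_num

lemma varIntegrand_nonneg {t : ℝ} (ht : 0 < t) : 0 ≤ varIntegrand t := by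
  rw [varIntegrand_eq]
  exact mul_nonneg (by linarith [binetKernel_nonneg ht])
    (div_nonneg ht.le (exp_sub_one_pos (half_pos ht)).le)

lemma varIntegrand_le {t : ℝ} (ht : 0 < t) :
    varIntegrand t ≤ 2 * Real.exp (-(1 / 4) * t) := by
  have h1 := mul_le_mul_of_nonneg_left (one_div_exp_sub_one_le (half_pos ht)) ht.le
  have h2 : 0 ≤ t / (Real.exp (t / 2) - 1) :=
    div_nonneg ht.le (exp_sub_one_pos (half_pos ht)).le
  rw [varIntegrand_eq]
  calc _ ≤ 1 * (t / (Real.exp (t / 2) - 1)) :=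
        mul_le_mul_of_nonneg_right (by linarith [binetKernel_le_half ht]) h2
    _ = t * (1 / (Real.exp (t / 2) - 1)) := by ring
    _ ≤ t * (1 / (t / 2) * Real.exp (-(t / 2 / 2))) := h1
    _ = 2 * Real.exp (-(1 / 4) * t) := by
        rw [show -(t / 2 / 2) = -(1 / 4) * t by ring]
        field_simp

lemma measurable_binetKernel : Measurable binetKernel := by
  unfold binetKernel
  fun_prop

lemma measurable_meanIntegrand : Measurable meanIntegrand := by
  unfold meanIntegrand
  fun_prop

lemma measurable_varIntegrand : Measurable varIntegrand := by
  unfold varIntegrand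
  fun_prop

lemma integrableOn_exp_neg_mul {a : ℝ} (ha : 0 < a) :
    IntegrableOn (fun t : ℝ => Real.exp (-a * t)) (Set.Ioi 0) :=
  integrableOn_exp_mul_Ioi (by linarith) 0

lemma integral_exp_neg_mul {a : ℝ} (ha : 0 < a) :
    ∫ t in Set.Ioi (0 : ℝ), Real.exp (-a * t) = 1 / a := by
  rw [integral_exp_mul_Ioi (by linarith) 0]
  simp

/-- A nonnegative measurable function dominated by an exponential is integrable. -/
lemma integrableOn_of_le_exp {g : ℝ → ℝ} (hg : Measurable g) {c a : ℝ} (ha : 0 < a)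
    (h0 : ∀ t, 0 < t → 0 ≤ g t) (h1 : ∀ t, 0 < t → g t ≤ c * Real.exp (-a * t)) :
    IntegrableOn g (Set.Ioi 0) := by
  refine Integrable.mono' ((integrableOn_exp_neg_mul ha).const_mul c) hg.aestronglyMeasurable ?_
  refine (ae_restrict_iff' measurableSet_Ioi).2 (Filter.Eventually.of_forall fun t ht => ?_)
  rw [Real.norm_of_nonneg (h0 t ht)]
  exact h1 t ht

lemma setIntegral_Ioi_nonneg {g : ℝ → ℝ} (h0 : ∀ t, 0 < t → 0 ≤ g t) :
    0 ≤ ∫ t in Set.Ioi (0 : ℝ), g t :=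
  setIntegral_nonneg measurableSet_Ioi fun t ht => h0 t ht

lemma setIntegral_le_of_le_exp {g : ℝ → ℝ} (hg : Measurable g) {c a : ℝ} (ha : 0 < a)
    (h0 : ∀ t, 0 < t → 0 ≤ g t) (h1 : ∀ t, 0 < t → g t ≤ c * Real.exp (-a * t)) :
    ∫ t in Set.Ioi (0 : ℝ), g t ≤ c / a := by
  have h2 := setIntegral_mono_on (integrableOn_of_le_exp hg ha h0 h1)
    ((integrableOn_exp_neg_mul ha).const_mul c) measurableSet_Ioi fun t ht => h1 t ht
  rw [integral_const_mul, integral_exp_neg_mul ha] at h2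
  rwa [div_eq_mul_one_div]

lemma integrableOn_meanIntegrand : IntegrableOn meanIntegrand (Set.Ioi 0) :=
  integrableOn_of_le_exp measurable_meanIntegrand (by norm_num : (0 : ℝ) < 1 / 4)
    (fun _ ht => meanIntegrand_nonneg ht) (fun _ ht => meanIntegrand_le ht)

lemma integrableOn_varIntegrand : IntegrableOn varIntegrand (Set.Ioi 0) :=
  integrableOn_of_le_exp measurable_varIntegrand (by norm_num : (0 : ℝ) < 1 / 4)
    (fun _ ht => varIntegrand_nonneg ht) (fun _ ht => varIntegrand_le ht)

lemma gaussC1_pos : 0 < gaussC1 := by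
  have h1 := setIntegral_Ioi_nonneg fun t ht => varIntegrand_nonneg (t := t) ht
  have h2 := Real.one_half_lt_eulerMascheroniConstant
  rw [gaussC1]
  linarith

lemma one_div_one_sub_exp_neg {t : ℝ} (ht : 0 < t) :
    1 / (1 - Real.exp (-t)) = binetKernel t + 1 / 2 + 1 / t := by
  have he := exp_sub_one_pos ht
  have he' := Real.exp_pos t
  have : 1 - Real.exp (-t) = (Real.exp t - 1) / Real.exp t := by
    rw [Real.exp_neg]
    field_simp
  rw [this, binetKernel]
  field_simp
  ring

/-- Sums of geometric progressions of exponentials. -/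
lemma sum_exp_neg_add_mul (x : ℝ) {t : ℝ} (ht : 0 < t) (m : ℕ) :
    ∑ j ∈ Finset.range m, Real.exp (-(x + j) * t) =
      Real.exp (-x * t) * (1 - Real.exp (-(m : ℝ) * t)) * (binetKernel t + 1 / 2 + 1 / t) := by
  have h1 : Real.exp (-t) < 1 := Real.exp_lt_one_iff.2 (by linarith)
  have h2 : ∀ j : ℕ, Real.exp (-(x + j) * t) = Real.exp (-x * t) * Real.exp (-t) ^ j := fun j => by
    rw [← Real.exp_nat_mul, ← Real.exp_add]
    ring_nf
  simp_rw [h2]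
  rw [← Finset.mul_sum, geom_sum_eq h1.ne, ← one_div_one_sub_exp_neg ht, ← Real.exp_nat_mul,
    show (m : ℝ) * -t = -(m : ℝ) * t by ring]
  have h3 : Real.exp (-t) - 1 ≠ 0 := by linarith
  have h4 : 1 - Real.exp (-t) ≠ 0 := by linarith
  field_simp
  ring

lemma sum_one_div_add {x : ℝ} (hx : 0 < x) (m : ℕ) :
    ∑ j ∈ Finset.range m, 1 / (x + j) = Real.log ((x + m) / x) + 1 / (2 * x) +
      (∫ t in Set.Ioi (0 : ℝ), binetKernel t * Real.exp (-x * t)) -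
      ∫ t in Set.Ioi (0 : ℝ), (binetKernel t + 1 / 2) * Real.exp (-(x + m) * t) := by
  have hxm : 0 < x + m := by positivity
  have hb : ∀ y : ℝ, 0 < y → IntegrableOn (fun t => binetKernel t * Real.exp (-y * t))
      (Set.Ioi 0) := fun y hy =>
    integrableOn_of_le_exp (c := 1 / 2) (measurable_binetKernel.mul (by fun_prop)) hy
      (fun t ht => mul_nonneg (binetKernel_nonneg ht) (Real.exp_pos _).le)
      (fun t ht => mul_le_mul_of_nonneg_right (binetKernel_le_half ht) (Real.exp_pos _).le)
  have hb2 : ∀ y : ℝ, 0 < y → IntegrableOn (fun t => (binetKernel t + 1 / 2) * Real.exp (-y * t))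
      (Set.Ioi 0) := fun y hy => by
    have := (hb y hy).add ((integrableOn_exp_neg_mul hy).const_mul (1 / 2))
    refine this.congr (Filter.Eventually.of_forall fun t => ?_)
    simp only [Pi.add_apply]
    ring
  have hj : ∀ j ∈ Finset.range m, IntegrableOn (fun t : ℝ => Real.exp (-(x + j) * t))
      (Set.Ioi 0) := fun j _ => integrableOn_exp_neg_mul (by positivity)
  have hsum : ∑ j ∈ Finset.range m, 1 / (x + j) =
      ∫ t in Set.Ioi (0 : ℝ), ∑ j ∈ Finset.range m, Real.exp (-(x + j) * t) := by
    rw [integral_finsetSum _ hj]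
    exact Finset.sum_congr rfl fun j _ => (integral_exp_neg_mul (by positivity)).symm
  have hsumint : IntegrableOn (fun t : ℝ => ∑ j ∈ Finset.range m, Real.exp (-(x + j) * t))
      (Set.Ioi 0) := integrable_finsetSum _ hj
  have hsplit : ∀ t ∈ Set.Ioi (0 : ℝ), t⁻¹ • (Real.exp (-(x * t)) - Real.exp (-((x + m) * t))) =
      ∑ j ∈ Finset.range m, Real.exp (-(x + j) * t) -
        ((binetKernel t + 1 / 2) * Real.exp (-x * t) -
          (binetKernel t + 1 / 2) * Real.exp (-(x + m) * t)) := by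
    intro t ht
    rw [sum_exp_neg_add_mul x ht, smul_eq_mul,
      show Real.exp (-(x + m) * t) = Real.exp (-x * t) * Real.exp (-m * t) by
        rw [← Real.exp_add]; ring_nf,
      show Real.exp (-((x + m) * t)) = Real.exp (-x * t) * Real.exp (-m * t) by
        rw [← Real.exp_add]; ring_nf, show -(x * t) = -x * t by ring]
    ring
  have hFint : IntegrableOn
      (fun t : ℝ => t⁻¹ • (Real.exp (-(x * t)) - Real.exp (-((x + m) * t)))) (Set.Ioi 0) := by
    refine IntegrableOn.congr_fun ?_ (fun t ht => (hsplit t ht).symm) measurableSet_Ioi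
    exact hsumint.sub ((hb2 x hx).sub (hb2 _ hxm))
  have hF := Frullani.integral_Ioi_eq (f := fun t : ℝ => Real.exp (-t)) (a := x) (b := x + m)
    (L := 1) (R := 0)
    ((by fun_prop : Continuous fun t : ℝ => Real.exp (-t)).locallyIntegrable.locallyIntegrableOn _)
    hx hxm
    (by
      have : Continuous fun t : ℝ => Real.exp (-t) := by fun_prop
      have h := this.tendsto 0
      simp only [neg_zero, Real.exp_zero] at h
      exact h.mono_left nhdsWithin_le_nhds)
    (Real.tendsto_exp_neg_atTop_nhds_zero) hFint
  have hdiff : IntegrableOn (fun t => (binetKernel t + 1 / 2) * Real.exp (-x * t) -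
      (binetKernel t + 1 / 2) * Real.exp (-(x + m) * t)) (Set.Ioi 0) := (hb2 x hx).sub (hb2 _ hxm)
  rw [setIntegral_congr_fun measurableSet_Ioi hsplit, integral_sub hsumint hdiff,
    integral_sub (hb2 x hx) (hb2 _ hxm), ← hsum] at hF
  have hx2 : ∫ t in Set.Ioi (0 : ℝ), (binetKernel t + 1 / 2) * Real.exp (-x * t) =
      (∫ t in Set.Ioi (0 : ℝ), binetKernel t * Real.exp (-x * t)) + 1 / (2 * x) := by
    simp_rw [add_mul]
    rw [integral_add (hb x hx) ((integrableOn_exp_neg_mul hx).const_mul (1 / 2)),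
      integral_const_mul, integral_exp_neg_mul hx]
    congr 1
    field_simp
  rw [hx2] at hF
  simp only [smul_eq_mul, sub_zero, mul_one] at hF
  linarith

open Filter Topology in
/-- Binet's formula for the digamma function, as a limit of partial sums. -/
lemma tendsto_log_sub_sum_one_div_add {x : ℝ} (hx : 0 < x) :
    Tendsto (fun m : ℕ => Real.log m - ∑ j ∈ Finset.range (m + 1), 1 / (x + j)) atTop
      (𝓝 (Real.log x - 1 / (2 * x) -
        ∫ t in Set.Ioi (0 : ℝ), binetKernel t * Real.exp (-x * t))) := by
  set B := ∫ t in Set.Ioi (0 : ℝ), binetKernel t * Real.exp (-x * t) with hB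
  have hR : Tendsto (fun m : ℕ => ∫ t in Set.Ioi (0 : ℝ),
      (binetKernel t + 1 / 2) * Real.exp (-(x + (m + 1 : ℕ)) * t)) atTop (𝓝 0) := by
    have h1 : Tendsto (fun m : ℕ => 1 / (x + (m + 1 : ℕ))) atTop (𝓝 0) := by
      have : Tendsto (fun m : ℕ => x + ((m + 1 : ℕ) : ℝ)) atTop atTop :=
        tendsto_atTop_add_const_left _ _
          (tendsto_natCast_atTop_atTop.comp (tendsto_add_atTop_nat 1))
      simpa [Pi.inv_def] using this.inv_tendsto_atTop
    refine squeeze_zero (fun m => ?_) (fun m => ?_) h1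
    · exact setIntegral_Ioi_nonneg fun t ht =>
        mul_nonneg (by linarith [binetKernel_nonneg ht]) (Real.exp_pos _).le
    · refine setIntegral_le_of_le_exp ((measurable_binetKernel.add_const _).mul (by fun_prop))
        (by positivity) (fun t ht => mul_nonneg (by linarith [binetKernel_nonneg ht])
          (Real.exp_pos _).le) fun t ht => ?_
      exact mul_le_mul_of_nonneg_right (by linarith [binetKernel_le_half ht]) (Real.exp_pos _).le
  have hL : Tendsto (fun m : ℕ => Real.log ((m : ℝ) / (x + (m + 1 : ℕ)))) atTop (𝓝 0) := by
    have h1 : Tendsto (fun m : ℕ => (m : ℝ) / (x + (m + 1 : ℕ))) atTop (𝓝 1) := by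
      have h2 := tendsto_natCast_div_add_atTop (x + 1 : ℝ)
      refine h2.congr fun m => ?_
      push_cast
      ring_nf
    have h3 := (Real.continuousAt_log one_ne_zero).tendsto.comp h1
    rwa [Real.log_one] at h3
  have h := (hL.add hR).const_add (Real.log x - 1 / (2 * x) - B)
  rw [add_zero, add_zero] at h
  refine h.congr' ?_
  filter_upwards [eventually_gt_atTop 0] with m hm
  have hm' : (0 : ℝ) < m := by exact_mod_cast hm
  rw [sum_one_div_add hx, Real.log_div hm'.ne' (by positivity), Real.log_div (by positivity) hx.ne']
  ring

/-- The mean of the logarithm of the absolute determinant of an `n × n` Gaussian matrix. -/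
noncomputable def meanLogDet (n : ℕ) : ℝ :=
  ∑ k ∈ Finset.range n, 1 / 2 * (Real.log 2 + (Real.log (((k : ℝ) + 1) / 2) -
    1 / (2 * (((k : ℝ) + 1) / 2)) -
      ∫ t in Set.Ioi (0 : ℝ), binetKernel t * Real.exp (-(((k : ℝ) + 1) / 2) * t)))

/-- The variance of the logarithm of the absolute determinant of an `n × n` Gaussian matrix. -/
noncomputable def varLogDet (n : ℕ) : ℝ :=
  1 / 2 * (harmonic n : ℝ) + 1 / 4 * (∫ t in Set.Ioi (0 : ℝ), varIntegrand t) -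
    1 / 4 * ∫ t in Set.Ioi (0 : ℝ), varIntegrand t * Real.exp (-((n : ℝ) / 2) * t)

lemma sum_exp_neg_half_mul {t : ℝ} (ht : 0 < t) (n : ℕ) :
    ∑ k ∈ Finset.range n, Real.exp (-(((k : ℝ) + 1) / 2) * t) =
      (1 - Real.exp (-((n : ℝ) / 2) * t)) * (1 / (Real.exp (t / 2) - 1)) := by
  have h0 : Real.exp (-(t / 2)) ≠ 0 := (Real.exp_pos _).ne'
  have h1 : Real.exp (-(t / 2)) < 1 := Real.exp_lt_one_iff.2 (by linarith)
  have h2 : ∀ k : ℕ, Real.exp (-(((k : ℝ) + 1) / 2) * t) =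
      Real.exp (-(t / 2)) * Real.exp (-(t / 2)) ^ k := fun k => by
    rw [← Real.exp_nat_mul, ← Real.exp_add]
    ring_nf
  have h3 : Real.exp (t / 2) = (Real.exp (-(t / 2)))⁻¹ := by rw [Real.exp_neg, inv_inv]
  have h4 : Real.exp (-((n : ℝ) / 2) * t) = Real.exp (-(t / 2)) ^ n := by
    rw [← Real.exp_nat_mul]
    ring_nf
  simp_rw [h2]
  rw [← Finset.mul_sum, geom_sum_eq h1.ne, h4, h3]
  set q := Real.exp (-(t / 2)) with hq
  have h5 : q - 1 ≠ 0 := by linarith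
  have h6 : q⁻¹ - 1 ≠ 0 := by
    rw [show q⁻¹ - 1 = -(q - 1) / q by field_simp; ring]
    exact div_ne_zero (neg_ne_zero.2 h5) h0
  have h7 : 1 - q ≠ 0 := by linarith
  rw [show q⁻¹ - 1 = (1 - q) / q by field_simp]
  field_simp
  ring

lemma harmonic_cast_eq (n : ℕ) :
    (harmonic n : ℝ) = ∑ k ∈ Finset.range n, 1 / ((k : ℝ) + 1) := by
  rw [harmonic]
  push_cast
  simp

lemma log_factorial_eq_sum (n : ℕ) :
    Real.log (n.factorial : ℝ) = ∑ k ∈ Finset.range n, Real.log ((k : ℝ) + 1) := by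
  induction n with
  | zero => simp
  | succ n ih =>
    rw [Finset.sum_range_succ, ← ih, Nat.factorial_succ]
    push_cast
    rw [Real.log_mul (by positivity) (by positivity), add_comm]

lemma integrableOn_meanIntegrand_mul_exp {a : ℝ} (ha : 0 < a) :
    IntegrableOn (fun t => meanIntegrand t * Real.exp (-a * t)) (Set.Ioi 0) :=
  integrableOn_of_le_exp (c := 1 / 2) (measurable_meanIntegrand.mul (by fun_prop)) ha
    (fun t ht => mul_nonneg (meanIntegrand_nonneg ht) (Real.exp_pos _).le)
    (fun t ht => mul_le_mul_of_nonneg_right ((meanIntegrand_le ht).trans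
      (mul_le_of_le_one_right (by norm_num) (Real.exp_le_one_iff.2 (by linarith))))
      (Real.exp_pos _).le)

lemma integral_meanIntegrand_mul_exp_mem {a : ℝ} (ha : 0 < a) :
    (∫ t in Set.Ioi (0 : ℝ), meanIntegrand t * Real.exp (-a * t)) ∈ Set.Icc 0 (1 / 2 / a) :=
  ⟨setIntegral_Ioi_nonneg fun t ht => mul_nonneg (meanIntegrand_nonneg ht) (Real.exp_pos _).le,
    setIntegral_le_of_le_exp (measurable_meanIntegrand.mul (by fun_prop)) ha
    (fun t ht => mul_nonneg (meanIntegrand_nonneg ht) (Real.exp_pos _).le)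
    (fun t ht => mul_le_mul_of_nonneg_right ((meanIntegrand_le ht).trans
      (mul_le_of_le_one_right (by norm_num) (Real.exp_le_one_iff.2 (by linarith))))
      (Real.exp_pos _).le)⟩

lemma varIntegrand_le_two {t : ℝ} (ht : 0 < t) : varIntegrand t ≤ 2 :=
  (varIntegrand_le ht).trans
    (mul_le_of_le_one_right (by norm_num) (Real.exp_le_one_iff.2 (by linarith)))

lemma integrableOn_varIntegrand_mul_exp {a : ℝ} (ha : 0 < a) :
    IntegrableOn (fun t => varIntegrand t * Real.exp (-a * t)) (Set.Ioi 0) :=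
  integrableOn_of_le_exp (c := 2) (measurable_varIntegrand.mul (by fun_prop)) ha
    (fun t ht => mul_nonneg (varIntegrand_nonneg ht) (Real.exp_pos _).le)
    (fun t ht => mul_le_mul_of_nonneg_right (varIntegrand_le_two ht) (Real.exp_pos _).le)

lemma integral_varIntegrand_mul_exp_mem {a : ℝ} (ha : 0 < a) :
    (∫ t in Set.Ioi (0 : ℝ), varIntegrand t * Real.exp (-a * t)) ∈ Set.Icc 0 (2 / a) :=
  ⟨setIntegral_Ioi_nonneg fun t ht => mul_nonneg (varIntegrand_nonneg ht) (Real.exp_pos _).le,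
    setIntegral_le_of_le_exp (measurable_varIntegrand.mul (by fun_prop)) ha
    (fun t ht => mul_nonneg (varIntegrand_nonneg ht) (Real.exp_pos _).le)
    (fun t ht => mul_le_mul_of_nonneg_right (varIntegrand_le_two ht) (Real.exp_pos _).le)⟩

lemma meanLogDet_eq {n : ℕ} (hn : 0 < n) :
    meanLogDet n = 1 / 2 * Real.log (n.factorial : ℝ) - 1 / 2 * (harmonic n : ℝ) -
      1 / 2 * (∫ t in Set.Ioi (0 : ℝ), meanIntegrand t) +
      1 / 2 * ∫ t in Set.Ioi (0 : ℝ), meanIntegrand t * Real.exp (-((n : ℝ) / 2) * t) := by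
  have hn' : (0 : ℝ) < n := by exact_mod_cast hn
  have hint : ∀ k ∈ Finset.range n, IntegrableOn
      (fun t => binetKernel t * Real.exp (-(((k : ℝ) + 1) / 2) * t)) (Set.Ioi 0) := fun k _ =>
    integrableOn_of_le_exp (c := 1 / 2) (a := ((k : ℝ) + 1) / 2)
      (measurable_binetKernel.mul (by fun_prop)) (by positivity)
      (fun t ht => mul_nonneg (binetKernel_nonneg ht) (Real.exp_pos _).le)
      (fun t ht => mul_le_mul_of_nonneg_right (binetKernel_le_half ht) (Real.exp_pos _).le)
  have hsum : ∑ k ∈ Finset.range n,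
      ∫ t in Set.Ioi (0 : ℝ), binetKernel t * Real.exp (-(((k : ℝ) + 1) / 2) * t) =
      (∫ t in Set.Ioi (0 : ℝ), meanIntegrand t) -
        ∫ t in Set.Ioi (0 : ℝ), meanIntegrand t * Real.exp (-((n : ℝ) / 2) * t) := by
    rw [← integral_finsetSum _ hint, ← integral_sub integrableOn_meanIntegrand
      (integrableOn_meanIntegrand_mul_exp (by positivity))]
    refine setIntegral_congr_fun measurableSet_Ioi fun t ht => ?_
    rw [← Finset.mul_sum, sum_exp_neg_half_mul ht, meanIntegrand_eq]
    ring
  have hterm : ∀ k ∈ Finset.range n, 1 / 2 * (Real.log 2 + (Real.log (((k : ℝ) + 1) / 2) -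
      1 / (2 * (((k : ℝ) + 1) / 2)) -
      ∫ t in Set.Ioi (0 : ℝ), binetKernel t * Real.exp (-(((k : ℝ) + 1) / 2) * t))) =
      1 / 2 * (Real.log ((k : ℝ) + 1) - 1 / ((k : ℝ) + 1) -
      ∫ t in Set.Ioi (0 : ℝ), binetKernel t * Real.exp (-(((k : ℝ) + 1) / 2) * t)) := by
    intro k _
    rw [Real.log_div (by positivity) (by norm_num),
      show 2 * (((k : ℝ) + 1) / 2) = (k : ℝ) + 1 by ring]
    ring
  rw [meanLogDet, Finset.sum_congr rfl hterm, ← Finset.mul_sum, Finset.sum_sub_distrib,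
    Finset.sum_sub_distrib, hsum, ← log_factorial_eq_sum, ← harmonic_cast_eq]
  ring

lemma abs_harmonic_sub_log_le {n : ℕ} (hn : 0 < n) :
    |(harmonic n : ℝ) - Real.log n - Real.eulerMascheroniConstant| ≤ 1 / n := by
  have hn' : (0 : ℝ) < n := by exact_mod_cast hn
  have h1 := Real.eulerMascheroniSeq_lt_eulerMascheroniConstant n
  have h2 := Real.eulerMascheroniConstant_lt_eulerMascheroniSeq' n
  rw [Real.eulerMascheroniSeq] at h1
  rw [Real.eulerMascheroniSeq', if_neg hn.ne'] at h2
  have h3 : Real.log ((n : ℝ) + 1) - Real.log n ≤ 1 / n := by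
    rw [← Real.log_div (by positivity) (by positivity)]
    refine (Real.log_le_sub_one_of_pos (by positivity)).trans (le_of_eq ?_)
    field_simp
    ring
  rw [abs_le]
  constructor <;> linarith [one_div_pos.2 hn']

lemma abs_meanLogDet_sub_le {n : ℕ} (hn : 0 < n) :
    |meanLogDet n - (1 / 2 * Real.log ((n - 1).factorial : ℝ) + gaussC0)| ≤ 1 / n := by
  have hn' : (0 : ℝ) < n := by exact_mod_cast hn
  have h1 := abs_le.1 (abs_harmonic_sub_log_le hn)
  obtain ⟨h2, h3⟩ := integral_meanIntegrand_mul_exp_mem (a := (n : ℝ) / 2) (by positivity)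
  have h4 : Real.log (n.factorial : ℝ) = Real.log n + Real.log ((n - 1).factorial : ℝ) := by
    rw [← Real.log_mul (by positivity) (by positivity)]
    congr 1
    exact_mod_cast (Nat.mul_factorial_pred hn.ne').symm
  have h5 : 1 / 2 / ((n : ℝ) / 2) = 1 / n := by field_simp
  rw [h5] at h3
  rw [meanLogDet_eq hn, gaussC0, h4, abs_le]
  constructor <;> linarith [h1.1, h1.2]

lemma abs_varLogDet_sub_le {n : ℕ} (hn : 0 < n) :
    |varLogDet n - (1 / 2 * Real.log n + gaussC1)| ≤ 2 / n := by
  have hn' : (0 : ℝ) < n := by exact_mod_cast hn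
  have h1 := abs_le.1 (abs_harmonic_sub_log_le hn)
  obtain ⟨h2, h3⟩ := integral_varIntegrand_mul_exp_mem (a := (n : ℝ) / 2) (by positivity)
  have h5 : 2 / ((n : ℝ) / 2) = 4 * (1 / n) := by field_simp; norm_num
  have h6 : 2 / (n : ℝ) = 2 * (1 / n) := by ring
  rw [h5] at h3
  rw [varLogDet, gaussC1, abs_le, h6]
  have := one_div_pos.2 hn'
  constructor <;> linarith [h1.1, h1.2]

lemma integral_mul_exp_neg_mul {a : ℝ} (ha : 0 < a) :
    ∫ t in Set.Ioi (0 : ℝ), t * Real.exp (-a * t) = 1 / a ^ 2 := by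
  have h := Real.integral_rpow_mul_exp_neg_mul_Ioi (a := 2) (r := a) (by norm_num) ha
  rw [Real.Gamma_two, mul_one, Real.rpow_two, one_div_pow] at h
  rw [← h]
  refine setIntegral_congr_fun measurableSet_Ioi fun t ht => ?_
  rw [show (2 : ℝ) - 1 = 1 by norm_num, Real.rpow_one, neg_mul]

lemma integrableOn_mul_exp_neg_mul {a : ℝ} (ha : 0 < a) :
    IntegrableOn (fun t : ℝ => t * Real.exp (-a * t)) (Set.Ioi 0) := by
  refine Integrable.of_integral_ne_zero ?_
  rw [integral_mul_exp_neg_mul ha]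
  positivity

open Filter Topology in
lemma tendsto_sum_one_div_sq {n : ℕ} (hn : 0 < n) :
    Tendsto (fun m : ℕ => ∑ k ∈ Finset.range n, ∑ j ∈ Finset.range (m + 1),
      (1 / ((k : ℝ) + 1 + 2 * j)) ^ 2) atTop (𝓝 (varLogDet n)) := by
  have hn' : (0 : ℝ) < n := by exact_mod_cast hn
  set U : ℝ → ℝ := fun t => varIntegrand t - varIntegrand t * Real.exp (-((n : ℝ) / 2) * t) +
    ∑ k ∈ Finset.range n, Real.exp (-(((k : ℝ) + 1) / 2) * t) with hU
  have hexp : ∀ k ∈ Finset.range n, IntegrableOn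
      (fun t => Real.exp (-(((k : ℝ) + 1) / 2) * t)) (Set.Ioi 0) := fun k _ =>
    integrableOn_exp_neg_mul (by positivity)
  have hA : IntegrableOn (fun t => varIntegrand t - varIntegrand t * Real.exp (-((n : ℝ) / 2) * t))
      (Set.Ioi 0) :=
    integrableOn_varIntegrand.sub (integrableOn_varIntegrand_mul_exp (by positivity))
  have hUint : IntegrableOn U (Set.Ioi 0) := hA.add (integrable_finsetSum _ hexp)
  have hUmeas : Measurable U := by
    refine (measurable_varIntegrand.sub (measurable_varIntegrand.mul (by fun_prop))).add ?_
    fun_prop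
  have hU0 : ∀ t, 0 < t → 0 ≤ U t := fun t ht => by
    have h1 : 0 ≤ varIntegrand t * (1 - Real.exp (-((n : ℝ) / 2) * t)) :=
      mul_nonneg (varIntegrand_nonneg ht) (sub_nonneg.2 (Real.exp_le_one_iff.2 (by
        have := mul_pos hn' ht
        linarith)))
    have h2 : 0 ≤ ∑ k ∈ Finset.range n, Real.exp (-(((k : ℝ) + 1) / 2) * t) :=
      Finset.sum_nonneg fun _ _ => (Real.exp_pos _).le
    simp only [hU]
    linarith
  have hU1 : ∀ t, 0 < t → U t ≤ 2 + n := fun t ht => by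
    have h1 : 0 ≤ varIntegrand t * Real.exp (-((n : ℝ) / 2) * t) :=
      mul_nonneg (varIntegrand_nonneg ht) (Real.exp_pos _).le
    have h2 : ∑ k ∈ Finset.range n, Real.exp (-(((k : ℝ) + 1) / 2) * t) ≤
        ∑ k ∈ Finset.range n, (1 : ℝ) := Finset.sum_le_sum fun k _ =>
      Real.exp_le_one_iff.2 (by
        have : 0 < ((k : ℝ) + 1) * t := by positivity
        linarith)
    simp only [Finset.sum_const, Finset.card_range, nsmul_eq_mul, mul_one] at h2
    simp only [hU]
    linarith [varIntegrand_le_two ht]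
  have hUval : ∫ t in Set.Ioi (0 : ℝ), U t = 4 * varLogDet n := by
    rw [hU, integral_add hA (integrable_finsetSum _ hexp), integral_sub integrableOn_varIntegrand
      (integrableOn_varIntegrand_mul_exp (by positivity)), integral_finsetSum _ hexp, varLogDet,
      harmonic_cast_eq]
    have h1 : ∀ k ∈ Finset.range n, ∫ t in Set.Ioi (0 : ℝ),
        Real.exp (-(((k : ℝ) + 1) / 2) * t) = 2 * (1 / ((k : ℝ) + 1)) := fun k _ => by
      rw [integral_exp_neg_mul (by positivity)]
      field_simp
    rw [Finset.sum_congr rfl h1, ← Finset.mul_sum]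
    ring
  have hUexp0 : ∀ m : ℕ, ∀ t, 0 < t → 0 ≤ U t * Real.exp (-((m + 1 : ℕ) : ℝ) * t) := fun m t ht =>
    mul_nonneg (hU0 t ht) (Real.exp_pos _).le
  have hUexp1 : ∀ m : ℕ, ∀ t, 0 < t → U t * Real.exp (-((m + 1 : ℕ) : ℝ) * t) ≤
      (2 + n) * Real.exp (-((m + 1 : ℕ) : ℝ) * t) := fun m t ht =>
    mul_le_mul_of_nonneg_right (hU1 t ht) (Real.exp_pos _).le
  have hUexpm : ∀ m : ℕ, Measurable fun t => U t * Real.exp (-((m + 1 : ℕ) : ℝ) * t) := fun m =>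
    hUmeas.mul (by fun_prop)
  have hval : ∀ m : ℕ, ∑ k ∈ Finset.range n, ∑ j ∈ Finset.range (m + 1),
      (1 / ((k : ℝ) + 1 + 2 * j)) ^ 2 = varLogDet n -
        1 / 4 * ∫ t in Set.Ioi (0 : ℝ), U t * Real.exp (-((m + 1 : ℕ) : ℝ) * t) := by
    intro m
    have h1 : ∀ k j : ℕ, (1 / ((k : ℝ) + 1 + 2 * j)) ^ 2 =
        1 / 4 * ∫ t in Set.Ioi (0 : ℝ), t * Real.exp (-(((k : ℝ) + 1) / 2 + j) * t) := fun k j => by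
      rw [integral_mul_exp_neg_mul (by positivity), one_div_pow,
        show ((k : ℝ) + 1 + 2 * j) = 2 * (((k : ℝ) + 1) / 2 + j) by ring, mul_pow]
      field_simp
      norm_num
    have h2 : ∀ k ∈ Finset.range n, ∀ j ∈ Finset.range (m + 1), IntegrableOn
        (fun t => t * Real.exp (-(((k : ℝ) + 1) / 2 + j) * t)) (Set.Ioi 0) := fun k _ j _ =>
      integrableOn_mul_exp_neg_mul (by positivity)
    simp_rw [h1, ← Finset.mul_sum]
    have h3 : ∑ k ∈ Finset.range n, ∑ j ∈ Finset.range (m + 1),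
        ∫ t in Set.Ioi (0 : ℝ), t * Real.exp (-(((k : ℝ) + 1) / 2 + j) * t) =
        ∫ t in Set.Ioi (0 : ℝ), ∑ k ∈ Finset.range n, ∑ j ∈ Finset.range (m + 1),
          t * Real.exp (-(((k : ℝ) + 1) / 2 + j) * t) := by
      rw [integral_finsetSum _ fun k hk => integrable_finsetSum _ (h2 k hk)]
      exact Finset.sum_congr rfl fun k hk => (integral_finsetSum _ (h2 k hk)).symm
    have h4 : ∀ t ∈ Set.Ioi (0 : ℝ), ∑ k ∈ Finset.range n, ∑ j ∈ Finset.range (m + 1),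
          t * Real.exp (-(((k : ℝ) + 1) / 2 + j) * t) =
        U t - U t * Real.exp (-((m + 1 : ℕ) : ℝ) * t) := by
      intro t ht
      have ht' : (0 : ℝ) < t := ht
      simp_rw [← Finset.mul_sum, sum_exp_neg_add_mul _ ht']
      rw [← Finset.sum_mul, ← Finset.sum_mul]
      simp only [hU]
      rw [sum_exp_neg_half_mul ht', varIntegrand_eq]
      have he := exp_sub_one_pos (half_pos ht')
      field_simp
    rw [h3, setIntegral_congr_fun measurableSet_Ioi h4, integral_sub hUint
      (integrableOn_of_le_exp (hUexpm m) (by positivity) (hUexp0 m) (hUexp1 m)), hUval]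
    ring
  simp_rw [hval]
  have hlim : Tendsto (fun m : ℕ => ∫ t in Set.Ioi (0 : ℝ),
      U t * Real.exp (-((m + 1 : ℕ) : ℝ) * t)) atTop (𝓝 0) := by
    have h1 : Tendsto (fun m : ℕ => (2 + n : ℝ) / ((m + 1 : ℕ) : ℝ)) atTop (𝓝 0) :=
      (tendsto_const_div_atTop_nhds_zero_nat (2 + n : ℝ)).comp (tendsto_add_atTop_nat 1)
    exact squeeze_zero (fun m => setIntegral_Ioi_nonneg (hUexp0 m))
      (fun m => setIntegral_le_of_le_exp (hUexpm m) (by positivity) (hUexp0 m) (hUexp1 m)) h1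
  have h := (hlim.const_mul (1 / 4)).const_sub (varLogDet n)
  rwa [mul_zero, sub_zero] at h

open Filter Topology in
lemma tendsto_meanLogDet (n : ℕ) :
    Tendsto (fun m : ℕ => ∑ k ∈ Finset.range n, (1 / 2 * Real.log 2 + 1 / 2 * Real.log m -
      ∑ j ∈ Finset.range (m + 1), 1 / ((k : ℝ) + 1 + 2 * j))) atTop (𝓝 (meanLogDet n)) := by
  refine tendsto_finsetSum _ fun k _ => ?_
  have h := ((tendsto_log_sub_sum_one_div_add (x := ((k : ℝ) + 1) / 2) (by positivity)).const_add
    (Real.log 2)).const_mul (1 / 2)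
  refine h.congr fun m => ?_
  have h1 : ∀ j : ℕ, 1 / ((k : ℝ) + 1 + 2 * j) = 1 / 2 * (1 / (((k : ℝ) + 1) / 2 + j)) := fun j => by
    field_simp
  simp_rw [h1, ← Finset.mul_sum]
  ring

lemma sum_one_div_add_two_mul_cube_le {a : ℝ} (ha : 1 ≤ a) (m : ℕ) :
    ∑ j ∈ Finset.range m, (1 / (a + 2 * j)) ^ 3 ≤ 2 / a ^ 2 - 2 / (a + 2 * m) ^ 2 := by
  induction m with
  | zero => simp
  | succ m ih =>
    rw [Finset.sum_range_succ]
    set l : ℝ := a + 2 * m with hl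
    have hl1 : 1 ≤ l := by
      have : (0 : ℝ) ≤ m := Nat.cast_nonneg m
      linarith
    have h1 : a + 2 * ((m + 1 : ℕ) : ℝ) = l + 2 := by push_cast; ring
    rw [h1]
    have h2 : (1 / l) ^ 3 ≤ 2 / l ^ 2 - 2 / (l + 2) ^ 2 := by
      rw [div_sub_div _ _ (by positivity) (by positivity), one_div_pow,
        div_le_div_iff₀ (by positivity) (by positivity)]
      have h3 : 0 ≤ l ^ 2 * ((2 * (l + 2) ^ 2 - l ^ 2 * 2) * l - (l + 2) ^ 2) := by
        refine mul_nonneg (sq_nonneg l) ?_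
        nlinarith
      nlinarith
    linarith

lemma sum_one_div_sq_le (n : ℕ) :
    ∑ k ∈ Finset.range n, 2 / ((k : ℝ) + 1) ^ 2 ≤ 4 - 4 / ((n : ℝ) + 1) := by
  induction n with
  | zero => simp
  | succ n ih =>
    rw [Finset.sum_range_succ]
    have h : 2 / ((n : ℝ) + 1) ^ 2 ≤ 4 / ((n : ℝ) + 1) - 4 / ((n : ℝ) + 1 + 1) := by
      rw [div_sub_div _ _ (by positivity) (by positivity),
        div_le_div_iff₀ (by positivity) (by positivity)]
      have hn : (0 : ℝ) ≤ n := Nat.cast_nonneg n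
      nlinarith [mul_nonneg hn hn]
    push_cast
    linarith

lemma sum_sum_one_div_cube_le (n m : ℕ) :
    ∑ k ∈ Finset.range n, ∑ j ∈ Finset.range m, (1 / ((k : ℝ) + 1 + 2 * j)) ^ 3 ≤ 4 := by
  have h1 : ∀ k ∈ Finset.range n, ∑ j ∈ Finset.range m, (1 / ((k : ℝ) + 1 + 2 * j)) ^ 3 ≤
      2 / ((k : ℝ) + 1) ^ 2 := fun k _ => by
    have h2 := sum_one_div_add_two_mul_cube_le (a := (k : ℝ) + 1)
      (by linarith [(Nat.cast_nonneg k : (0 : ℝ) ≤ k)]) m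
    have h3 : 0 ≤ 2 / ((k : ℝ) + 1 + 2 * m) ^ 2 := by positivity
    linarith
  have h4 : (0 : ℝ) ≤ 4 / ((n : ℝ) + 1) := by positivity
  linarith [Finset.sum_le_sum h1, sum_one_div_sq_le n]

lemma norm_exp_sub_one_le_of_re_nonpos {a : ℂ} (ha : a.re ≤ 0) : ‖Complex.exp a - 1‖ ≤ ‖a‖ := by
  have hconv : Convex ℝ {z : ℂ | z.re ≤ 0} := convex_halfSpace_re_le 0
  have h := hconv.norm_image_sub_le_of_norm_deriv_le (f := Complex.exp) (C := 1) (x := 0) (y := a)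
    (fun z _ => Complex.differentiableAt_exp) (fun z hz => by
      rw [Complex.deriv_exp, Complex.norm_exp]
      exact Real.exp_le_one_iff.2 hz) (by simp) ha
  simpa using h

lemma norm_exp_sub_one_le_norm_mul (a : ℂ) :
    ‖Complex.exp a - 1‖ ≤ ‖a‖ * (1 + ‖Complex.exp a‖) := by
  rcases le_total a.re 0 with h | h
  · refine (norm_exp_sub_one_le_of_re_nonpos h).trans ?_
    exact le_mul_of_one_le_right (norm_nonneg _) (by linarith [norm_nonneg (Complex.exp a)])
  · have h1 : Complex.exp a - 1 = -(Complex.exp a * (Complex.exp (-a) - 1)) := by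
      rw [mul_sub, ← Complex.exp_add, add_neg_cancel, Complex.exp_zero]
      ring
    have h2 := norm_exp_sub_one_le_of_re_nonpos (a := -a) (by simpa using h)
    rw [norm_neg] at h2
    rw [h1, norm_neg, norm_mul]
    calc _ ≤ ‖Complex.exp a‖ * ‖a‖ := by gcongr
      _ ≤ _ := by nlinarith [norm_nonneg a]

lemma norm_one_add_I_mul (u : ℝ) : ‖(1 + Complex.I * u : ℂ)‖ = Real.sqrt (1 + u ^ 2) := by
  rw [Complex.norm_eq_sqrt_sq_add_sq]
  simp

lemma one_add_I_mul_ne_zero (u : ℝ) : (1 + Complex.I * u : ℂ) ≠ 0 := by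
  rw [← norm_ne_zero_iff, norm_one_add_I_mul]
  positivity

lemma exists_inv_one_add_I_mul_eq_exp {u : ℝ} (hu : |u| ≤ 1 / 2) :
    ∃ r : ℂ, (1 + Complex.I * u : ℂ)⁻¹ = Complex.exp (-(Complex.I * u) - u ^ 2 / 2 + r) ∧
      ‖r‖ ≤ |u| ^ 3 := by
  have hz : ‖(Complex.I * u : ℂ)‖ = |u| := by simp
  have h := Complex.norm_log_sub_logTaylor_le 2 (z := Complex.I * u) (by rw [hz]; linarith)
  refine ⟨-(Complex.log (1 + Complex.I * u) - Complex.logTaylor 3 (Complex.I * u)), ?_, ?_⟩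
  · have h2 : Complex.logTaylor 3 (Complex.I * u) = Complex.I * u + u ^ 2 / 2 := by
      rw [Complex.logTaylor_succ, Complex.logTaylor_succ, Complex.logTaylor_succ,
        Complex.logTaylor_zero]
      simp only [Pi.add_apply]
      norm_num
      rw [mul_pow, Complex.I_sq]
      ring
    rw [h2, show -(Complex.I * (u : ℂ)) - u ^ 2 / 2 +
      -(Complex.log (1 + Complex.I * u) - (Complex.I * u + u ^ 2 / 2)) =
        -Complex.log (1 + Complex.I * u) by ring, Complex.exp_neg,
      Complex.exp_log (one_add_I_mul_ne_zero u)]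
  · rw [norm_neg]
    refine h.trans ?_
    rw [hz]
    have h3 : (1 - |u|)⁻¹ ≤ 2 := by
      rw [inv_le_comm₀ (by linarith) (by norm_num)]
      linarith
    have h4 : 0 ≤ |u| ^ 3 := by positivity
    have h5 : |u| ^ (2 + 1) * (1 - |u|)⁻¹ ≤ |u| ^ 3 * 2 := mul_le_mul_of_nonneg_left h3 h4
    push_cast
    rw [div_le_iff₀ (by norm_num)]
    linarith

section FiniteProducts

variable {ι : Type*} (D : Finset ι) (w : ι → ℝ)

lemma exists_prod_inv_one_add_I_mul_eq_exp (hw : ∀ p ∈ D, 0 ≤ w p ∧ w p ≤ 1) {s : ℝ}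
    (hs : |s| ≤ 1 / 2) :
    ∃ r : ℂ, ∏ p ∈ D, (1 + Complex.I * ((s * w p : ℝ) : ℂ))⁻¹ =
      Complex.exp (-(Complex.I * s * ((∑ p ∈ D, w p : ℝ) : ℂ)) -
        s ^ 2 * ((∑ p ∈ D, w p ^ 2 : ℝ) : ℂ) / 2 + r) ∧
      ‖r‖ ≤ |s| ^ 3 * ∑ p ∈ D, w p ^ 3 := by
  have h : ∀ p : ι, ∃ r : ℂ, p ∈ D → (1 + Complex.I * ((s * w p : ℝ) : ℂ))⁻¹ =
      Complex.exp (-(Complex.I * ((s * w p : ℝ) : ℂ)) - ((s * w p : ℝ) : ℂ) ^ 2 / 2 + r) ∧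
      ‖r‖ ≤ |s * w p| ^ 3 := by
    intro p
    by_cases hp : p ∈ D
    · obtain ⟨h0, h1⟩ := hw p hp
      obtain ⟨r, hr⟩ := exists_inv_one_add_I_mul_eq_exp (u := s * w p) (by
        rw [abs_mul, abs_of_nonneg h0]
        exact (mul_le_of_le_one_right (abs_nonneg s) h1).trans hs)
      exact ⟨r, fun _ => hr⟩
    · exact ⟨0, fun h => absurd h hp⟩
  choose r hr using h
  refine ⟨∑ p ∈ D, r p, ?_, ?_⟩
  · rw [Finset.prod_congr rfl fun p hp => (hr p hp).1, ← Complex.exp_sum]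
    congr 1
    rw [Finset.sum_add_distrib, Finset.sum_sub_distrib]
    push_cast
    rw [Finset.mul_sum, Finset.mul_sum, Finset.sum_div, ← Finset.sum_neg_distrib]
    congr 1
    congr 1
    · exact Finset.sum_congr rfl fun p _ => by ring
    · exact Finset.sum_congr rfl fun p _ => by ring
  · refine (norm_sum_le _ _).trans ?_
    rw [Finset.mul_sum]
    refine Finset.sum_le_sum fun p hp => (hr p hp).2.trans (le_of_eq ?_)
    rw [abs_mul, abs_of_nonneg (hw p hp).1, mul_pow]

lemma norm_prod_inv_one_add_I_mul_le (hw : ∀ p ∈ D, 0 ≤ w p ∧ w p ≤ 1) {s : ℝ}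
    (hs : |s| ≤ 1 / 2) :
    ‖∏ p ∈ D, (1 + Complex.I * ((s * w p : ℝ) : ℂ))⁻¹‖ ≤
      Real.exp (-(s ^ 2 * (∑ p ∈ D, w p ^ 2) / 4)) := by
  rw [norm_prod, Finset.mul_sum, Finset.sum_div, ← Finset.sum_neg_distrib, Real.exp_sum]
  refine Finset.prod_le_prod (fun _ _ => norm_nonneg _) fun p hp => ?_
  obtain ⟨h0, h1⟩ := hw p hp
  have hs2 : s ^ 2 ≤ 1 := by
    rw [← sq_abs]
    nlinarith [abs_nonneg s]
  set y := (s * w p) ^ 2 with hy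
  have hy0 : 0 ≤ y := sq_nonneg _
  have hy1 : y ≤ 1 := by
    rw [hy, mul_pow]
    exact mul_le_one₀ hs2 (sq_nonneg _) (pow_le_one₀ h0 h1)
  rw [norm_inv, norm_one_add_I_mul, Real.exp_neg, ← hy, ← mul_pow, ← hy]
  refine inv_anti₀ (Real.exp_pos _) ?_
  refine Real.le_sqrt_of_sq_le ?_
  rw [← Real.exp_nat_mul]
  have h2 : Real.exp (((2 : ℕ) : ℝ) * (y / 4)) = (Real.exp (-(y / 2)))⁻¹ := by
    rw [← Real.exp_neg]
    congr 1
    push_cast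
    ring
  rw [h2]
  have h3 : 1 - y / 2 ≤ Real.exp (-(y / 2)) := by linarith [Real.add_one_le_exp (-(y / 2))]
  refine (inv_anti₀ (by linarith) h3).trans ?_
  rw [inv_le_iff_one_le_mul₀ (by linarith)]
  nlinarith

lemma norm_prod_inv_one_add_I_mul_mul_sqrt_le {p₀ : ι} (hp₀ : p₀ ∈ D) (hw₀ : w p₀ = 1) {s : ℝ}
    (hs : 1 / 2 ≤ |s|) :
    ‖∏ p ∈ D, (1 + Complex.I * ((s * w p : ℝ) : ℂ))⁻¹‖ * Real.sqrt (1 + s ^ 2) ≤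
      ‖∏ p ∈ D, (1 + Complex.I * ((1 / 2 * w p : ℝ) : ℂ))⁻¹‖ * Real.sqrt (1 + (1 / 2) ^ 2) := by
  classical
  have hfac : ∀ s : ℝ, ‖∏ p ∈ D, (1 + Complex.I * ((s * w p : ℝ) : ℂ))⁻¹‖ * Real.sqrt (1 + s ^ 2) =
      ∏ p ∈ D.erase p₀, (Real.sqrt (1 + (s * w p) ^ 2))⁻¹ := by
    intro s
    rw [norm_prod, ← Finset.mul_prod_erase D _ hp₀, norm_inv, norm_one_add_I_mul, hw₀, mul_one,
      mul_right_comm, inv_mul_cancel₀ (by positivity), one_mul]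
    exact Finset.prod_congr rfl fun p _ => by rw [norm_inv, norm_one_add_I_mul]
  rw [hfac, hfac]
  refine Finset.prod_le_prod (fun p _ => by positivity) fun p _ => ?_
  refine inv_anti₀ (by positivity) (Real.sqrt_le_sqrt ?_)
  have h1 : (1 / 2 : ℝ) ^ 2 ≤ s ^ 2 := by
    rw [← sq_abs s]
    gcongr
  rw [mul_pow, mul_pow]
  have := mul_le_mul_of_nonneg_right h1 (sq_nonneg (w p))
  linarith

end FiniteProducts

/-- The characteristic function of the logarithm of the absolute determinant of a Gaussian
matrix. -/
noncomputable def charLogDet (n : ℕ) (s : ℝ) : ℂ :=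
  ∫ M, Complex.exp (Complex.I * s * Real.log |(Matrix.of M).det|) ∂gaussMat n

lemma charLogDet_eq_prod (n : ℕ) (s : ℝ) :
    charLogDet n s = ∏ k ∈ Finset.range n, (2 ^ (Complex.I * s / 2) *
      Complex.Gamma (((k : ℂ) + 1 + Complex.I * s) / 2) / Complex.Gamma (((k : ℂ) + 1) / 2)) := by
  have h := integral_abs_det_cpow n (Complex.I * s)
  rw [Finset.prod_congr rfl fun k _ => integral_norm_cpow_stdGaussian k (z := Complex.I * s) (by
    simp; linarith [(Nat.cast_nonneg k : (0 : ℝ) ≤ k)])] at h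
  rw [← h, charLogDet]
  refine integral_congr_ae ?_
  filter_upwards [ae_det_ne_zero n] with M hM
  rw [Complex.cpow_def_of_ne_zero (by exact_mod_cast hM), ← Complex.ofReal_log (abs_nonneg _),
    mul_comm]

/-- The set of index pairs in the finite products approximating `charLogDet`. -/
def indexPairs (n m : ℕ) : Finset (ℕ × ℕ) := Finset.range n ×ˢ Finset.range (m + 1)

/-- The weights in the finite products approximating `charLogDet`. -/
noncomputable def indexWeight (p : ℕ × ℕ) : ℝ := 1 / ((p.1 : ℝ) + 1 + 2 * p.2)

lemma indexWeight_mem (p : ℕ × ℕ) : 0 ≤ indexWeight p ∧ indexWeight p ≤ 1 := by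
  unfold indexWeight
  have h1 : (0 : ℝ) ≤ p.1 := Nat.cast_nonneg _
  have h2 : (0 : ℝ) ≤ p.2 := Nat.cast_nonneg _
  refine ⟨by positivity, ?_⟩
  rw [div_le_one (by positivity)]
  linarith

lemma GammaSeq_div_GammaSeq (k : ℕ) (s : ℝ) {m : ℕ} (hm : 0 < m) :
    2 ^ (Complex.I * s / 2) * Complex.GammaSeq (((k : ℂ) + 1 + Complex.I * s) / 2) m /
      Complex.GammaSeq (((k : ℂ) + 1) / 2) m =
    Complex.exp (Complex.I * s * ((1 / 2 * Real.log 2 + 1 / 2 * Real.log m : ℝ) : ℂ)) *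
      ∏ j ∈ Finset.range (m + 1), (1 + Complex.I * ((s * indexWeight (k, j) : ℝ) : ℂ))⁻¹ := by
  have hm' : (0 : ℝ) < m := by exact_mod_cast hm
  have hmc : (m : ℂ) ≠ 0 := by exact_mod_cast hm.ne'
  have hfac : ((m.factorial : ℕ) : ℂ) ≠ 0 := by exact_mod_cast m.factorial_ne_zero
  have hx : ∀ j : ℕ, ((k : ℂ) + 1) / 2 + j ≠ 0 := fun j => by
    have : (((k : ℂ) + 1) / 2 + j) = (((((k : ℝ) + 1) / 2 + j : ℝ)) : ℂ) := by push_cast; ring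
    rw [this]
    exact_mod_cast (by positivity : (((k : ℝ) + 1) / 2 + j) ≠ 0)
  have hfactor : ∀ j : ℕ, ((k : ℂ) + 1 + Complex.I * s) / 2 + j =
      (((k : ℂ) + 1) / 2 + j) * (1 + Complex.I * ((s * indexWeight (k, j) : ℝ) : ℂ)) := fun j => by
    have h2 : ((k : ℂ) + 1 + 2 * j) ≠ 0 := by
      have := hx j
      intro h
      apply this
      linear_combination h / 2
    rw [indexWeight]
    push_cast
    field_simp
    ring
  rw [Complex.GammaSeq, Complex.GammaSeq]
  simp_rw [hfactor]
  rw [Finset.prod_mul_distrib, Finset.prod_inv_distrib]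
  have hp1 : ∏ j ∈ Finset.range (m + 1), (((k : ℂ) + 1) / 2 + j) ≠ 0 :=
    Finset.prod_ne_zero_iff.2 fun j _ => hx j
  have hp2 : ∏ j ∈ Finset.range (m + 1),
      (1 + Complex.I * ((s * indexWeight (k, j) : ℝ) : ℂ)) ≠ 0 :=
    Finset.prod_ne_zero_iff.2 fun j _ => one_add_I_mul_ne_zero _
  have hpow : (m : ℂ) ^ (((k : ℂ) + 1 + Complex.I * s) / 2) =
      (m : ℂ) ^ (((k : ℂ) + 1) / 2) * (m : ℂ) ^ (Complex.I * s / 2) := by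
    rw [← Complex.cpow_add _ _ hmc]
    congr 1
    ring
  have hpow0 : (m : ℂ) ^ (((k : ℂ) + 1) / 2) ≠ 0 := by
    rw [Complex.cpow_def_of_ne_zero hmc]
    exact Complex.exp_ne_zero _
  have hexp : (2 : ℂ) ^ (Complex.I * s / 2) * (m : ℂ) ^ (Complex.I * s / 2) =
      Complex.exp (Complex.I * s * ((1 / 2 * Real.log 2 + 1 / 2 * Real.log m : ℝ) : ℂ)) := by
    rw [Complex.cpow_def_of_ne_zero two_ne_zero, Complex.cpow_def_of_ne_zero hmc,
      ← Complex.exp_add]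
    congr 1
    push_cast
    rw [Complex.ofReal_log (by norm_num)]
    push_cast
    ring
  rw [hpow, ← hexp]
  generalize ∏ j ∈ Finset.range (m + 1), (((k : ℂ) + 1) / 2 + j) = p₁ at hp1 ⊢
  generalize ∏ j ∈ Finset.range (m + 1),
    (1 + Complex.I * ((s * indexWeight (k, j) : ℝ) : ℂ)) = p₂ at hp2 ⊢
  field_simp

open Filter Topology in
lemma tendsto_charLogDet (n : ℕ) (s : ℝ) :
    Tendsto (fun m : ℕ =>
      Complex.exp (Complex.I * s *
        ((∑ _k ∈ Finset.range n, (1 / 2 * Real.log 2 + 1 / 2 * Real.log m) : ℝ) : ℂ)) *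
      ∏ p ∈ indexPairs n m, (1 + Complex.I * ((s * indexWeight p : ℝ) : ℂ))⁻¹)
      atTop (𝓝 (charLogDet n s)) := by
  rw [charLogDet_eq_prod]
  have h : Tendsto (fun m : ℕ => ∏ k ∈ Finset.range n, (2 ^ (Complex.I * s / 2) *
      Complex.GammaSeq (((k : ℂ) + 1 + Complex.I * s) / 2) m /
        Complex.GammaSeq (((k : ℂ) + 1) / 2) m)) atTop
      (𝓝 (∏ k ∈ Finset.range n, (2 ^ (Complex.I * s / 2) *
      Complex.Gamma (((k : ℂ) + 1 + Complex.I * s) / 2) / Complex.Gamma (((k : ℂ) + 1) / 2)))) := by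
    refine tendsto_finsetProd _ fun k _ => ?_
    refine Tendsto.div ((Complex.GammaSeq_tendsto_Gamma _).const_mul _)
      (Complex.GammaSeq_tendsto_Gamma _) ?_
    refine Complex.Gamma_ne_zero_of_re_pos ?_
    have : (((k : ℂ) + 1) / 2).re = ((k : ℝ) + 1) / 2 := by simp
    rw [this]
    positivity
  refine h.congr' ?_
  filter_upwards [eventually_gt_atTop 0] with m hm
  rw [Finset.prod_congr rfl fun k _ => GammaSeq_div_GammaSeq k s hm, Finset.prod_mul_distrib,
    ← Complex.exp_sum, indexPairs, Finset.prod_product]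
  congr 2
  push_cast
  rw [Finset.mul_sum]

open Filter Topology in
lemma tendsto_sum_indexWeight_sq {n : ℕ} (hn : 0 < n) :
    Tendsto (fun m : ℕ => ∑ p ∈ indexPairs n m, indexWeight p ^ 2) atTop (𝓝 (varLogDet n)) := by
  refine (tendsto_sum_one_div_sq hn).congr fun m => ?_
  rw [indexPairs, Finset.sum_product]
  rfl

open Filter Topology in
lemma tendsto_sum_indexWeight (n : ℕ) :
    Tendsto (fun m : ℕ => (∑ _k ∈ Finset.range n, (1 / 2 * Real.log 2 + 1 / 2 * Real.log m)) -
      ∑ p ∈ indexPairs n m, indexWeight p) atTop (𝓝 (meanLogDet n)) := by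
  refine (tendsto_meanLogDet n).congr fun m => ?_
  rw [indexPairs, Finset.sum_product, Finset.sum_sub_distrib]
  rfl

lemma norm_exp_I_mul (x y : ℝ) : ‖Complex.exp (Complex.I * x * y)‖ = 1 := by
  rw [show Complex.I * x * y = ((x * y : ℝ) : ℂ) * Complex.I by push_cast; ring,
    Complex.norm_exp_ofReal_mul_I]

open Filter Topology in
/-- Gaussian approximation of the characteristic function near the origin. -/
lemma norm_charLogDet_sub_le {n : ℕ} (hn : 0 < n) (a v : ℝ) {s : ℝ} (hs : |s| ≤ 1 / 2) :
    ‖Complex.exp (-(Complex.I * s * a)) * charLogDet n s - Complex.exp (-(v * s ^ 2 / 2))‖ ≤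
      (|s| * |meanLogDet n - a| + s ^ 2 * |varLogDet n - v| / 2 + 4 * |s| ^ 3) *
        (Real.exp (-(v * s ^ 2 / 2)) + Real.exp (-(s ^ 2 * varLogDet n / 4))) := by
  have hV := tendsto_sum_indexWeight_sq hn
  have hM := tendsto_sum_indexWeight n
  have hφ := tendsto_charLogDet n s
  refine le_of_tendsto_of_tendsto'
    ((hφ.const_mul (Complex.exp (-(Complex.I * s * a)))).sub_const _).norm
    ((((((hM.sub_const a).abs.const_mul |s|).add
      (((hV.sub_const v).abs.const_mul (s ^ 2)).div_const 2)).add_const (4 * |s| ^ 3))).mul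
      (((Real.continuous_exp.tendsto _).comp ((hV.const_mul (s ^ 2)).div_const 4).neg).const_add
        (Real.exp (-(v * s ^ 2 / 2))))) fun m => ?_
  have hwm : ∀ p ∈ indexPairs n m, 0 ≤ indexWeight p ∧ indexWeight p ≤ 1 :=
    fun p _ => indexWeight_mem p
  obtain ⟨r, hr, hrn⟩ := exists_prod_inv_one_add_I_mul_eq_exp (indexPairs n m) indexWeight hwm hs
  have hnorm := norm_prod_inv_one_add_I_mul_le (indexPairs n m) indexWeight hwm hs
  set Q := ∏ p ∈ indexPairs n m, (1 + Complex.I * ((s * indexWeight p : ℝ) : ℂ))⁻¹ with hQ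
  set θ := ∑ _k ∈ Finset.range n, (1 / 2 * Real.log 2 + 1 / 2 * Real.log m) with hθ
  set M1 := ∑ p ∈ indexPairs n m, indexWeight p with hM1
  set V1 := ∑ p ∈ indexPairs n m, indexWeight p ^ 2 with hV1
  have hcube : ∑ p ∈ indexPairs n m, indexWeight p ^ 3 ≤ 4 := by
    rw [indexPairs, Finset.sum_product]
    exact sum_sum_one_div_cube_le n (m + 1)
  have hr4 : ‖r‖ ≤ 4 * |s| ^ 3 := hrn.trans (by
    rw [mul_comm]
    exact mul_le_mul_of_nonneg_right hcube (by positivity))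
  set z : ℂ := Complex.I * s * ((θ - M1 - a : ℝ) : ℂ) - s ^ 2 * ((V1 - v : ℝ) : ℂ) / 2 + r with hz
  have hE : Complex.exp (-(Complex.I * s * a)) * (Complex.exp (Complex.I * s * θ) * Q) =
      Complex.exp (-(v * s ^ 2 / 2)) * Complex.exp z := by
    rw [hr, ← Complex.exp_add, ← Complex.exp_add, ← Complex.exp_add]
    congr 1
    rw [hz]
    push_cast
    ring
  have hG : ‖Complex.exp (-(v * s ^ 2 / 2) : ℂ)‖ = Real.exp (-(v * s ^ 2 / 2)) := by
    rw [show (-(v * s ^ 2 / 2) : ℂ) = ((-(v * s ^ 2 / 2) : ℝ) : ℂ) by push_cast; ring,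
      Complex.norm_exp_ofReal]
  have hQn : ‖Complex.exp (-(v * s ^ 2 / 2) : ℂ)‖ * ‖Complex.exp z‖ = ‖Q‖ := by
    rw [← norm_mul, ← hE, norm_mul, norm_mul, norm_exp_I_mul,
      show -(Complex.I * (s : ℂ) * a) = Complex.I * s * ((-a : ℝ) : ℂ) by push_cast; ring,
      norm_exp_I_mul, one_mul, one_mul]
  have hzn : ‖z‖ ≤ |s| * |θ - M1 - a| + s ^ 2 * |V1 - v| / 2 + 4 * |s| ^ 3 := by
    rw [hz]
    refine (norm_add_le _ _).trans (add_le_add ((norm_sub_le _ _).trans (le_of_eq ?_)) hr4)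
    rw [norm_mul, norm_mul, norm_div, norm_mul, norm_pow, Complex.norm_I, Complex.norm_real,
      Complex.norm_real, Complex.norm_real, Real.norm_eq_abs, Real.norm_eq_abs, Real.norm_eq_abs,
      sq_abs]
    simp
  rw [hE]
  calc ‖Complex.exp (-(v * s ^ 2 / 2)) * Complex.exp z - Complex.exp (-(v * s ^ 2 / 2))‖
      = ‖Complex.exp (-(v * s ^ 2 / 2) : ℂ)‖ * ‖Complex.exp z - 1‖ := by
        rw [← norm_mul]
        congr 1
        ring
    _ ≤ ‖Complex.exp (-(v * s ^ 2 / 2) : ℂ)‖ * (‖z‖ * (1 + ‖Complex.exp z‖)) := by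
        gcongr
        exact norm_exp_sub_one_le_norm_mul z
    _ = ‖z‖ * (Real.exp (-(v * s ^ 2 / 2)) + ‖Q‖) := by
        rw [← hQn, hG]
        ring
    _ ≤ _ := by
        gcongr
        exact hnorm

open Filter Topology in
/-- Decay of the characteristic function away from the origin. -/
lemma norm_charLogDet_mul_sqrt_le {n : ℕ} (hn : 0 < n) {s : ℝ} (hs : 1 / 2 ≤ |s|) :
    ‖charLogDet n s‖ * Real.sqrt (1 + s ^ 2) ≤ 2 * Real.exp (-(varLogDet n / 16)) := by
  have hV := tendsto_sum_indexWeight_sq hn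
  refine le_of_tendsto_of_tendsto' ((tendsto_charLogDet n s).norm.mul_const _)
    (((Real.continuous_exp.tendsto _).comp (hV.div_const 16).neg).const_mul 2) fun m => ?_
  have h1 := norm_prod_inv_one_add_I_mul_mul_sqrt_le (indexPairs n m) indexWeight
    (p₀ := (0, 0)) (by simp [indexPairs, hn]) (by simp [indexWeight]) hs
  have h2 := norm_prod_inv_one_add_I_mul_le (indexPairs n m) indexWeight
    (fun p _ => indexWeight_mem p) (s := 1 / 2) (by norm_num)
  have h3 : Real.sqrt (1 + (1 / 2) ^ 2) ≤ 2 := by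
    rw [Real.sqrt_le_left (by norm_num)]
    norm_num
  rw [norm_mul, norm_exp_I_mul, one_mul]
  refine h1.trans ?_
  calc _ ≤ Real.exp (-((1 / 2) ^ 2 * (∑ p ∈ indexPairs n m, indexWeight p ^ 2) / 4)) * 2 := by
        gcongr
    _ = 2 * Real.exp (-((∑ p ∈ indexPairs n m, indexWeight p ^ 2) / 16)) := by
        rw [mul_comm]
        congr 3
        ring

lemma integrable_sq_mul_exp_neg_mul_sq {b : ℝ} (hb : 0 < b) :
    Integrable fun s : ℝ => s ^ 2 * Real.exp (-b * s ^ 2) := by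
  have h := integrable_rpow_mul_exp_neg_mul_sq hb (s := 2) (by norm_num)
  simpa using h

lemma integral_sq_mul_exp_neg_mul_sq {b : ℝ} (hb : 0 < b) :
    ∫ s : ℝ, s ^ 2 * Real.exp (-b * s ^ 2) =
      (∫ x : ℝ, x ^ 2 * Real.exp (-1 * x ^ 2)) / (b * Real.sqrt b) := by
  have hs : 0 < Real.sqrt b := Real.sqrt_pos.2 hb
  have h := Measure.integral_comp_mul_left (fun x : ℝ => x ^ 2 * Real.exp (-1 * x ^ 2))
    (Real.sqrt b)
  simp only [mul_pow, Real.sq_sqrt hb.le, smul_eq_mul] at h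
  rw [abs_of_pos (inv_pos.2 hs)] at h
  have h2 : ∀ s : ℝ, b * s ^ 2 * Real.exp (-1 * (b * s ^ 2)) =
      b * (s ^ 2 * Real.exp (-b * s ^ 2)) := fun s => by
    rw [show -1 * (b * s ^ 2) = -b * s ^ 2 by ring]
    ring
  simp_rw [h2] at h
  rw [integral_const_mul] at h
  rw [eq_div_iff (by positivity)]
  calc _ = Real.sqrt b * (b * ∫ s : ℝ, s ^ 2 * Real.exp (-b * s ^ 2)) := by ring
    _ = _ := by rw [h]; field_simp

/-- The weighted difference between the characteristic function of the centred logarithmic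
determinant and that of a Gaussian variable of the same approximate variance. -/
noncomputable def charLogDetGap (n : ℕ) (s : ℝ) : ℝ :=
  ‖Complex.exp (-(Complex.I * s *
      ((1 / 2 * Real.log ((n - 1).factorial : ℝ) + gaussC0 : ℝ) : ℂ))) * charLogDet n s -
    Complex.exp (-(((1 / 2 * Real.log (n : ℝ) + gaussC1 : ℝ) : ℂ) * s ^ 2 / 2))‖ / |s|

/-- A dominating function for `charLogDetGap`. -/
noncomputable def gapBound (n : ℕ) (s : ℝ) : ℝ :=
  (6 / n * Real.exp (-(Real.log n / 8) * s ^ 2) +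
    20 * (s ^ 2 * Real.exp (-(Real.log n / 8) * s ^ 2))) +
    20 * Real.exp (-(Real.log n / 32)) * (1 + s ^ 2)⁻¹

lemma charLogDetGap_le {n : ℕ} (hn : 2 ≤ n) {s : ℝ} (hs0 : s ≠ 0) :
    charLogDetGap n s ≤ gapBound n s := by
  have hn' : (2 : ℝ) ≤ n := by exact_mod_cast hn
  have hn0 : 0 < n := by omega
  set L := Real.log n with hL
  have hL0 : 0 < L := Real.log_pos (by linarith)
  set a := 1 / 2 * Real.log ((n - 1).factorial : ℝ) + gaussC0 with ha
  set v := 1 / 2 * L + gaussC1 with hv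
  have hδ1 : |meanLogDet n - a| ≤ 1 / n := abs_meanLogDet_sub_le hn0
  have hδ2 : |varLogDet n - v| ≤ 2 / n := abs_varLogDet_sub_le hn0
  have hc := gaussC1_pos
  have h2n : 2 / (n : ℝ) ≤ 1 := by
    rw [div_le_one (by linarith)]
    exact hn'
  have hV : L / 2 - 1 ≤ varLogDet n := by
    have := (abs_le.1 hδ2).1
    linarith
  have hspos : 0 < |s| := abs_pos.2 hs0
  have hs2 : |s| ^ 2 = s ^ 2 := sq_abs s
  have hse : Real.exp (-(v * s ^ 2 / 2)) ≤ Real.exp (-(L / 8) * s ^ 2) := by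
    refine Real.exp_le_exp.2 ?_
    have : (L / 8) * s ^ 2 ≤ (v / 2) * s ^ 2 :=
      mul_le_mul_of_nonneg_right (by linarith) (sq_nonneg s)
    linarith
  rw [charLogDetGap, gapBound, ← ha, ← hL, ← hv]
  rcases le_total |s| (1 / 2) with hs | hs
  · have h1 := norm_charLogDet_sub_le hn0 a v hs
    have hs14 : s ^ 2 ≤ 1 / 4 := by nlinarith
    have h2 : Real.exp (-(s ^ 2 * varLogDet n / 4)) ≤ 2 * Real.exp (-(L / 8) * s ^ 2) := by
      have h3 : Real.exp (1 / 16) ≤ 2 := by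
        have := Real.exp_bound_div_one_sub_of_interval (x := 1 / 16) (by norm_num) (by norm_num)
        norm_num at this ⊢
        linarith
      calc Real.exp (-(s ^ 2 * varLogDet n / 4)) ≤ Real.exp (1 / 16 + -(L / 8) * s ^ 2) := by
            refine Real.exp_le_exp.2 ?_
            have := mul_le_mul_of_nonneg_left hV (sq_nonneg s)
            linarith
        _ ≤ _ := by
            rw [Real.exp_add]
            gcongr
    set E := Real.exp (-(L / 8) * s ^ 2) with hE
    have hE0 : 0 < E := Real.exp_pos _
    have h4 : |s| * |meanLogDet n - a| + s ^ 2 * |varLogDet n - v| / 2 + 4 * |s| ^ 3 ≤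
        |s| * (2 / n + 4 * s ^ 2) := by
      have h5 : |s| * |meanLogDet n - a| ≤ |s| * (1 / n) := by gcongr
      have h6 : s ^ 2 * |varLogDet n - v| / 2 ≤ |s| * (1 / n) := by
        have h7 : s ^ 2 * |varLogDet n - v| ≤ s ^ 2 * (2 / n) := by gcongr
        have h8 : s ^ 2 * (2 / n) ≤ |s| * (2 / n) := by
          refine mul_le_mul_of_nonneg_right ?_ (by positivity)
          rw [← hs2]
          nlinarith
        have h9 : |s| * (2 / (n : ℝ)) = 2 * (|s| * (1 / n)) := by ring
        linarith
      have h10 : |s| * (2 / n + 4 * s ^ 2) = |s| * (1 / n) + |s| * (1 / n) + 4 * |s| ^ 3 := by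
        rw [← hs2]
        ring
      linarith
    have h11 : 0 ≤ 20 * Real.exp (-(L / 32)) * (1 + s ^ 2)⁻¹ := by positivity
    rw [div_le_iff₀ hspos]
    calc _ ≤ _ := h1
      _ ≤ |s| * (2 / n + 4 * s ^ 2) * (E + 2 * E) := by gcongr
      _ = (6 / n * E + 12 * (s ^ 2 * E)) * |s| := by ring
      _ ≤ _ := by
        refine mul_le_mul_of_nonneg_right ?_ hspos.le
        have : 0 ≤ s ^ 2 * E := by positivity
        linarith
  · have h1 := norm_charLogDet_mul_sqrt_le hn0 hs
    have hG : ‖Complex.exp (-((v : ℂ) * s ^ 2 / 2))‖ = Real.exp (-(v * s ^ 2 / 2)) := by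
      rw [show (-((v : ℂ) * s ^ 2 / 2) : ℂ) = ((-(v * s ^ 2 / 2) : ℝ) : ℂ) by push_cast; ring,
        Complex.norm_exp_ofReal]
    have h2 : ‖Complex.exp (-(Complex.I * s * a)) * charLogDet n s‖ = ‖charLogDet n s‖ := by
      rw [norm_mul, show -(Complex.I * (s : ℂ) * a) = Complex.I * s * ((-a : ℝ) : ℂ) by
        push_cast; ring, norm_exp_I_mul, one_mul]
    have h3 : Real.exp (-(varLogDet n / 16)) ≤ 2 * Real.exp (-(L / 32)) := by
      have h3 : Real.exp (1 / 16) ≤ 2 := by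
        have := Real.exp_bound_div_one_sub_of_interval (x := 1 / 16) (by norm_num) (by norm_num)
        norm_num at this ⊢
        linarith
      calc Real.exp (-(varLogDet n / 16)) ≤ Real.exp (1 / 16 + -(L / 32)) :=
            Real.exp_le_exp.2 (by linarith)
        _ ≤ _ := by
            rw [Real.exp_add]
            gcongr
    have hs14 : 1 / 4 ≤ s ^ 2 := by nlinarith
    have h4 : ‖charLogDet n s‖ ≤ 20 * Real.exp (-(L / 32)) * (1 + s ^ 2)⁻¹ * |s| := by
      have h5 : |s| ≤ Real.sqrt (1 + s ^ 2) := Real.abs_le_sqrt (by linarith)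
      have h6 : ‖charLogDet n s‖ * |s| ≤ 4 * Real.exp (-(L / 32)) := by
        calc _ ≤ ‖charLogDet n s‖ * Real.sqrt (1 + s ^ 2) := by gcongr
          _ ≤ _ := by linarith
      have h7 : 4 * Real.exp (-(L / 32)) ≤ 20 * Real.exp (-(L / 32)) * (1 + s ^ 2)⁻¹ * |s| * |s| := by
        rw [mul_assoc _ |s|, ← sq, hs2, mul_assoc, mul_comm 20, mul_assoc, mul_comm 4]
        refine mul_le_mul_of_nonneg_left ?_ (Real.exp_pos _).le
        rw [inv_mul_eq_div, ← mul_div_assoc, le_div_iff₀ (by positivity)]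
        linarith
      exact le_of_mul_le_mul_right (h6.trans h7) hspos
    have h8 : Real.exp (-(L / 8) * s ^ 2) ≤ 20 * (s ^ 2 * Real.exp (-(L / 8) * s ^ 2)) * |s| := by
      have h9 : 1 ≤ 20 * s ^ 2 * |s| := by nlinarith
      have := mul_le_mul_of_nonneg_right h9 (Real.exp_pos (-(L / 8) * s ^ 2)).le
      linarith
    have h10 : 0 ≤ 6 / n * Real.exp (-(L / 8) * s ^ 2) * |s| := by positivity
    rw [div_le_iff₀ hspos]
    refine (norm_sub_le _ _).trans ?_
    rw [h2, hG]
    linarith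

lemma integrable_gapBound {n : ℕ} (hn : 2 ≤ n) : Integrable (gapBound n) := by
  have hL0 : 0 < Real.log n := Real.log_pos (by exact_mod_cast hn)
  exact (((integrable_exp_neg_mul_sq (by positivity)).const_mul _).add
    ((integrable_sq_mul_exp_neg_mul_sq (by positivity)).const_mul _)).add
    (integrable_inv_one_add_sq.const_mul _)

lemma exp_neg_div_le_rpow {L : ℝ} (hL : 0 < L) :
    Real.exp (-(L / 32)) ≤ 2048 / L ^ (3 / 2 : ℝ) := by
  have h1 : L ^ (3 / 2 : ℝ) ≤ 1 + L ^ 2 := by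
    rcases le_total L 1 with h | h
    · have := Real.rpow_le_one hL.le h (by norm_num : (0 : ℝ) ≤ 3 / 2)
      nlinarith [sq_nonneg L]
    · have := Real.rpow_le_rpow_of_exponent_le h (by norm_num : (3 / 2 : ℝ) ≤ 2)
      rw [Real.rpow_two] at this
      linarith
  have h2 := Real.quadratic_le_exp_of_nonneg (x := L / 32) (by positivity)
  have h3 : L ^ (3 / 2 : ℝ) ≤ 2048 * Real.exp (L / 32) := by nlinarith
  rw [Real.exp_neg, le_div_iff₀ (by positivity), inv_mul_le_iff₀ (Real.exp_pos _)]
  linarith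

lemma exists_integral_gapBound_le :
    ∃ C : ℝ, 0 < C ∧ ∀ n : ℕ, 2 ≤ n → ∫ s, gapBound n s ≤ C / Real.log n ^ (3 / 2 : ℝ) := by
  set K := ∫ x : ℝ, x ^ 2 * Real.exp (-1 * x ^ 2) with hK
  have hK0 : 0 ≤ K := integral_nonneg fun x => by positivity
  refine ⟨6 * Real.sqrt (Real.pi * 8) + 20 * K * (8 * Real.sqrt 8) + 20 * 2048 * Real.pi,
    by positivity, fun n hn => ?_⟩
  have hn' : (2 : ℝ) ≤ n := by exact_mod_cast hn
  set L := Real.log n with hL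
  have hL0 : 0 < L := Real.log_pos (by linarith)
  have hsL : 0 < Real.sqrt L := Real.sqrt_pos.2 hL0
  have hpow : L ^ (3 / 2 : ℝ) = L * Real.sqrt L := by
    rw [Real.sqrt_eq_rpow, show (3 / 2 : ℝ) = 1 + 1 / 2 by norm_num, Real.rpow_add hL0,
      Real.rpow_one]
  have h1 := integral_gaussian (L / 8)
  have h2 := integral_sq_mul_exp_neg_mul_sq (b := L / 8) (by positivity)
  have hi1 := (integrable_exp_neg_mul_sq (b := L / 8) (by positivity)).const_mul (6 / (n : ℝ))
  have hi2 := (integrable_sq_mul_exp_neg_mul_sq (b := L / 8) (by positivity)).const_mul 20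
  have hi3 := integrable_inv_one_add_sq.const_mul (20 * Real.exp (-(L / 32)))
  have hval : ∫ s, gapBound n s = 6 / n * Real.sqrt (Real.pi / (L / 8)) +
      20 * (K / (L / 8 * Real.sqrt (L / 8))) + 20 * Real.exp (-(L / 32)) * Real.pi := by
    have hi12 : Integrable fun s : ℝ => 6 / n * Real.exp (-(L / 8) * s ^ 2) +
      20 * (s ^ 2 * Real.exp (-(L / 8) * s ^ 2)) := hi1.add hi2
    unfold gapBound
    rw [← hL, integral_add hi12 hi3, integral_add hi1 hi2, integral_const_mul,
      integral_const_mul, integral_const_mul, h1, h2, integral_univ_inv_one_add_sq]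
  have hT1 : 6 / n * Real.sqrt (Real.pi / (L / 8)) ≤
      6 * Real.sqrt (Real.pi * 8) / L ^ (3 / 2 : ℝ) := by
    have hLn : L ≤ n := by
      have := Real.log_le_sub_one_of_pos (show (0 : ℝ) < n by linarith)
      linarith
    rw [show Real.pi / (L / 8) = Real.pi * 8 / L by field_simp, Real.sqrt_div (by positivity), hpow,
      div_mul_div_comm]
    gcongr
  have hT2 : 20 * (K / (L / 8 * Real.sqrt (L / 8))) = 20 * K * (8 * Real.sqrt 8) /
      L ^ (3 / 2 : ℝ) := by
    rw [Real.sqrt_div hL0.le, hpow]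
    field_simp
  have hT3 : 20 * Real.exp (-(L / 32)) * Real.pi ≤ 20 * 2048 * Real.pi / L ^ (3 / 2 : ℝ) := by
    have := mul_le_mul_of_nonneg_left (exp_neg_div_le_rpow hL0)
      (by positivity : 0 ≤ 20 * Real.pi)
    calc _ = 20 * Real.pi * Real.exp (-(L / 32)) := by ring
      _ ≤ _ := this
      _ = _ := by ring
  rw [hval, hT2, add_div, add_div]
  linarith

/-- The Kolmogorov distance to a Gaussian variable depends only on the law. -/
lemma ksDistGaussian_le {Ω : Type*} [MeasurableSpace Ω] {P : Measure Ω} {X : Ω → ℝ}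
    (hX : AEMeasurable X P) {c : ℝ}
    (h : ∀ r, |(P.map X).real (Set.Iio r) - (gaussianReal 0 1).real (Set.Iio r)| ≤ c) :
    ksDistGaussian P X ≤ c := by
  refine ciSup_le fun r => ?_
  have h1 : P.real {ω | X ω < r} = (P.map X).real (Set.Iio r) := by
    rw [measureReal_def, measureReal_def, Measure.map_apply_of_aemeasurable hX measurableSet_Iio]
    rfl
  have h2 : ∫ u in Set.Iic r, Real.exp (-u ^ 2 / 2) / Real.sqrt (2 * Real.pi) =
      (gaussianReal 0 1).real (Set.Iio r) := by
    rw [measureReal_def, gaussianReal_apply_eq_integral 0 one_ne_zero, ENNReal.toReal_ofReal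
      (integral_nonneg fun y => gaussianPDFReal_nonneg _ _ _), integral_Iic_eq_integral_Iio]
    refine integral_congr_ae (Filter.Eventually.of_forall fun u => ?_)
    simp only [gaussianPDFReal, NNReal.coe_one, mul_one, sub_zero]
    rw [div_eq_inv_mul]
  rw [h1, h2]
  exact h r

lemma measurable_charLogDet (n : ℕ) : Measurable (charLogDet n) := by
  unfold charLogDet
  refine (StronglyMeasurable.integral_prod_right
    (f := fun (s : ℝ) (M : Fin n → Fin n → ℝ) =>
      Complex.exp (Complex.I * s * Real.log |(Matrix.of M).det|)) ?_).measurable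
  refine Measurable.stronglyMeasurable ?_
  have h1 : Measurable fun p : ℝ × (Fin n → Fin n → ℝ) => Real.log |(Matrix.of p.2).det| :=
    Real.measurable_log.comp ((measurable_abs_det n).comp measurable_snd)
  simp only [Function.uncurry_def]
  fun_prop

lemma integrable_charLogDetGap {n : ℕ} (hn : 2 ≤ n) : Integrable (charLogDetGap n) := by
  refine (integrable_gapBound hn).mono' ?_ ?_
  · have := measurable_charLogDet n
    unfold charLogDetGap
    exact Measurable.aestronglyMeasurable (by fun_prop)
  · filter_upwards [Measure.ae_ne volume (0 : ℝ)] with s hs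
    rw [Real.norm_of_nonneg (by unfold charLogDetGap; positivity)]
    exact charLogDetGap_le hn hs

lemma charFun_standardized_eq {Ω : Type*} [MeasurableSpace Ω] {P : Measure Ω}
    {n : ℕ} {A : Ω → Matrix (Fin n) (Fin n) ℝ}
    (hA : HasLaw (fun ω => fun i j => A ω i j) (gaussMat n) P) (a σ t : ℝ) :
    charFun (P.map fun ω => (Real.log |(A ω).det| - a) / σ) t =
      Complex.exp (-(Complex.I * ((t / σ : ℝ) : ℂ) * a)) * charLogDet n (t / σ) := by
  have hm : Measurable fun M : Fin n → Fin n → ℝ => (Real.log |(Matrix.of M).det| - a) / σ :=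
    ((Real.measurable_log.comp (measurable_abs_det n)).sub_const a).div_const σ
  have hmap : (P.map fun ω => (Real.log |(A ω).det| - a) / σ) =
      (gaussMat n).map (fun M => (Real.log |(Matrix.of M).det| - a) / σ) := by
    rw [← hA.map_eq, AEMeasurable.map_map_of_aemeasurable hm.aemeasurable hA.aemeasurable]
    rfl
  rw [hmap, charFun_apply_real, integral_map hm.aemeasurable (by fun_prop), charLogDet,
    ← integral_const_mul]
  refine integral_congr_ae (Filter.Eventually.of_forall fun M => ?_)
  simp only
  rw [← Complex.exp_add]
  congr 1
  push_cast
  ring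

theorem theoremG :
    IntegrableOn meanIntegrand (Set.Ioi (0 : ℝ)) ∧
    IntegrableOn varIntegrand (Set.Ioi (0 : ℝ)) ∧
    0 < gaussC1 ∧
    ∃ C : ℝ, 0 < C ∧
      ∀ (n : ℕ), 2 ≤ n →
      ∀ (Ω : Type*) [MeasurableSpace Ω] (P : Measure Ω) [IsProbabilityMeasure P]
        (A : Ω → Matrix (Fin n) (Fin n) ℝ),
        (∀ i j, HasLaw (fun ω => A ω i j) (gaussianReal 0 1) P) →
        iIndepFun (fun (p : Fin n × Fin n) (ω : Ω) => A ω p.1 p.2) P →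
        ksDistGaussian P (fun ω =>
            (Real.log |(A ω).det| -
                (1 / 2 * Real.log ((n - 1).factorial : ℝ) + gaussC0)) /
              Real.sqrt (1 / 2 * Real.log (n : ℝ) + gaussC1))
          ≤ C / (Real.log (n : ℝ)) ^ (3 / 2 : ℝ) := by
  refine ⟨integrableOn_meanIntegrand, integrableOn_varIntegrand, gaussC1_pos, ?_⟩
  obtain ⟨C, hC, hbound⟩ := exists_integral_gapBound_le
  refine ⟨C, hC, fun n hn Ω _ P _ A hA hind => ?_⟩
  have hlaw := hasLaw_gaussMat hA hind
  have hL0 : 0 < Real.log n := Real.log_pos (by exact_mod_cast hn)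
  set a := 1 / 2 * Real.log ((n - 1).factorial : ℝ) + gaussC0 with ha
  have hv0 : 0 < 1 / 2 * Real.log (n : ℝ) + gaussC1 := by linarith [gaussC1_pos]
  set σ := Real.sqrt (1 / 2 * Real.log (n : ℝ) + gaussC1) with hσ
  have hσ0 : 0 < σ := Real.sqrt_pos.2 hv0
  have hm : Measurable fun M : Fin n → Fin n → ℝ => (Real.log |(Matrix.of M).det| - a) / σ :=
    ((Real.measurable_log.comp (measurable_abs_det n)).sub_const a).div_const σ
  have hX : AEMeasurable (fun ω => (Real.log |(A ω).det| - a) / σ) P :=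
    hm.comp_aemeasurable hlaw.aemeasurable
  have := Measure.isProbabilityMeasure_map hX
  have hgap : ∀ t, ‖charFun (P.map fun ω => (Real.log |(A ω).det| - a) / σ) t -
      charFun (gaussianReal 0 1) t‖ / |t| = σ⁻¹ * charLogDetGap n (t / σ) := by
    intro t
    have h1 : charFun (gaussianReal 0 1) t =
        Complex.exp (-(((1 / 2 * Real.log (n : ℝ) + gaussC1 : ℝ) : ℂ) *
          ((t / σ : ℝ) : ℂ) ^ 2 / 2)) := by
      rw [charFun_gaussianReal]
      congr 1
      have h2 : (1 / 2 * Real.log (n : ℝ) + gaussC1) * (t / σ) ^ 2 = t ^ 2 := by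
        rw [div_pow, hσ, Real.sq_sqrt hv0.le, mul_div_cancel₀ _ hv0.ne']
      have h3 : ((1 / 2 * Real.log (n : ℝ) + gaussC1 : ℝ) : ℂ) * ((t / σ : ℝ) : ℂ) ^ 2 =
          (t : ℂ) ^ 2 := by exact_mod_cast h2
      rw [h3]
      push_cast
      simp
    rw [charFun_standardized_eq hlaw, h1, charLogDetGap, abs_div, abs_of_pos hσ0, ← ha]
    field_simp
  have hint : Integrable fun t => ‖charFun (P.map fun ω => (Real.log |(A ω).det| - a) / σ) t -
      charFun (gaussianReal 0 1) t‖ / |t| := by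
    simp_rw [hgap]
    exact ((integrable_charLogDetGap hn).comp_div hσ0.ne').const_mul _
  refine ksDistGaussian_le hX fun r => ?_
  refine (abs_measureReal_Iio_sub_le _ _ hint r).trans ?_
  simp_rw [hgap]
  rw [integral_const_mul, Measure.integral_comp_div, abs_of_pos hσ0, smul_eq_mul,
    inv_mul_cancel_left₀ hσ0.ne']
  have h3 : ∫ s, charLogDetGap n s ≤ ∫ s, gapBound n s := by
    refine integral_mono_ae (integrable_charLogDetGap hn) (integrable_gapBound hn) ?_
    filter_upwards [Measure.ae_ne volume (0 : ℝ)] with s hs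
    exact charLogDetGap_le hn hs
  have h4 : 0 ≤ ∫ s, charLogDetGap n s :=
    integral_nonneg fun s => by unfold charLogDetGap; positivity
  have h5 : 1 / Real.pi ≤ 1 := by
    rw [div_le_one Real.pi_pos]
    linarith [Real.pi_gt_three]
  calc _ ≤ 1 * ∫ s, charLogDetGap n s := by gcongr
    _ ≤ _ := by linarith [hbound n hn]
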